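/- **Setting.** Let $m,p,L\ge 1$ and $T\ge L$ be integers, $q=m+p$. For symmetric real matrices, $A>0$ ($A\ge0$) means positive (semi)definite. For a symmetric block matrix $M=\begin{bmatrix}M_{11}&M_{12}\\M_{21}&M_{22}\end{bmatrix}$ put $M\,|\,M_{22}=M_{11}-M_{12}M_{22}^\dagger M_{21}$ ($\dagger$ is the Moore–Penrose pseudo-inverse). Consider systems $y(t+L)+\sum_{i=0}^{L-1}P_iy(t+i)=\sum_{i=0}^{L-1}Q_iu(t+i)+v(t)$ with $u(t)\in\mathbb R^m$, $y(t),v(t)\in\mathbb R^p$, and with coefficient matrix $R=[-Q_0\ P_0\ \cdots\ -Q_{L-1}\ P_{L-1}]\in\mathbb R^{p\times qL}$. Let data $u(0),\dots,u(T)$, $y(0),\dots,y(T)$ be given, $w(t)=\operatorname{col}(u(t),y(t))$; let $H_1'(w)\in\mathbb R^{qL\times(T-L+1)}$ have the block $w(t+i)$ in block row $i\in\{0,\dots,L-1\}$ and column $t\in\{0,\dots,T-L\}$, and let $H_2'(w)=[y(L)\ \cdots\ y(T)]$. Let $\Pi$ be a symmetric matrix of size $p+(T-L+1)$ with $\Pi_{22}<0$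 and $\Pi\,|\,\Pi_{22}\ge0$. A system is *compatible with the data* if $V:=RH_1'(w)+H_2'(w)$ satisfies $\begin{bmatrix}I\\V^\top\end{bmatrix}^\top\Pi\begin{bmatrix}I\\V^\top\end{bmatrix}\ge0$. It is assumed that some (the "true") system is compatible with the data. Define $N=\begin{bmatrix}I&H_2'(w)\\0&H_1'(w)\end{bmatrix}\Pi\begin{bmatrix}I&H_2'(w)\\0&H_1'(w)\end{bmatrix}^\top$ and $\bar N=E^\top NE$, where $E=\begin{bmatrix}[\,0_{p\times q(L-1)}\ \ 0_{p\times m}\ \ {-I_p}\,]&0\\0&I_{qL}\end{bmatrix}$; partition $\bar N$ into blocks of size $qL\times qL$. Let $J=[\,0\ \ I_{q(L-1)}\,]\in\mathbb R^{q(L-1)\times qL}$ and let $$W=\begin{bmatrix}I_{q(L-1)}&0&0\\0&0_{m\times p}&0\\0&I_p&0\\0&0&I_{qL}\end{bmatrix}\in\mathbb R^{2qL\times(2qL-m)} .$$ For a symmetric $\Psi\in\mathbb R^{qL\times qL}$ let $\nabla\Psi=\begin{bmatrix}0_q&0\\0&\Psi\end{bmatrix}-\begin{bmatrix}\Psi&0\\0&0_q\end{bmatrix}$,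 and for a symmetric matrix $\Phi$ consisting of $K\times K$ blocks $\Phi_{kl}\in\mathbb R^{q\times q}$ let $Q_\Phi(w)(t)=\sum_{k,l=0}^{K-1}w(t+k)^\top\Phi_{kl}\,w(t+l)$. The data are *informative for quadratic stabilization* if there are $C\in\mathbb R^{m\times qL}$ and $\Psi\ge0$ such that $$\begin{bmatrix}I\\-C\\-R\end{bmatrix}^\top\nabla\Psi\begin{bmatrix}I\\-C\\-R\end{bmatrix}<0\quad\text{for all }R\in\mathbb R^{p\times qL}\text{ with }\begin{bmatrix}I\\R^\top\end{bmatrix}^\top N\begin{bmatrix}I\\R^\top\end{bmatrix}\ge0 .$$ The controller with coefficient matrix $C=[G_0\ {-F_0}\ \cdots\ G_{L-1}\ {-F_{L-1}}]\in\mathbb R^{m\times qL}$ is $u(t+L)+\sum_{i=0}^{L-1}G_iu(t+i)=\sum_{i=0}^{L-1}F_iy(t+i)$. It *stabilizes* a system if all solutions $(u,y)$ on $\mathbb Z_+$ of the closed loop with $v=0$ tend to $0$. $Q_\Psi$ is a *Lyapunov function* of the closed loop if, for all solutions $w$ of the closed loop with $v=0$, $Q_\Psi(w)\ge0$ and $Q_{\nabla\Psi}(w)\le0$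 at all times, and $Q_{\nabla\Psi}(w)$ is identically $0$ only if $w=0$. **Theorem.** Assume that $H_1'(w)$ has full row rank. Then the data are informative for quadratic stabilization if and only if there is a symmetric $\Phi\in\mathbb R^{qL\times qL}$ such that $$\text{(a)}\quad \Phi>\bar N\,|\,\bar N_{22}$$ and $$\text{(b)}\quad \begin{bmatrix}W\\ [\,J^\top\ 0\ I_{qL}\,]\end{bmatrix}^\top\begin{bmatrix}\begin{bmatrix}\Phi&0\\0&0\end{bmatrix}-\bar N&0\\0&-\Phi\end{bmatrix}\begin{bmatrix}W\\ [\,J^\top\ 0\ I_{qL}\,]\end{bmatrix}>0 .$$ Moreover, if a symmetric $\Phi$ satisfies (a) and (b), then $\Phi$ and $W^\top\left(\begin{bmatrix}\Phi&0\\0&0\end{bmatrix}-\bar N\right)W$ are invertible, and the matrix $C$ given by $$C^\top=-[\,J^\top\ 0\ I_{qL}\,]\left(W^\top\left(\begin{bmatrix}\Phi&0\\0&0\end{bmatrix}-\bar N\right)W\right)^{-1}W^\top\begin{bmatrix}\Phi&0\\0&0\end{bmatrix}\begin{bmatrix}0_{q(L-1)\times m}\\I_m\\0_{(p+qL)\times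 m}\end{bmatrix}$$ satisfies, with $K=\begin{bmatrix}J\\-C\\0\end{bmatrix}\in\mathbb R^{qL\times qL}$, $$\begin{bmatrix}I&0\\0&I\\K^\top&I\end{bmatrix}^\top\begin{bmatrix}\begin{bmatrix}\Phi&0\\0&0\end{bmatrix}-\bar N&0\\0&-\Phi\end{bmatrix}\begin{bmatrix}I&0\\0&I\\K^\top&I\end{bmatrix}>0 .$$ Consequently, the controller with coefficient matrix $C$ stabilizes every system that is compatible with the data, and $Q_\Psi$ with $\Psi=\Phi^{-1}$ is a common Lyapunov function of all the resulting closed loops. -/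

import Mathlib

open Matrix Filter Topology

noncomputable section

namespace ARStab

/-! ## Pseudo-inverse, generalized Schur complement, quadratic matrix inequalities -/

/-- The four Penrose equations: `X` is a Moore-Penrose pseudo-inverse of the real matrix `A`. -/
def IsMoorePenrose {ι κ : Type*} [Fintype ι] [Fintype κ]
    (A : Matrix ι κ ℝ) (X : Matrix κ ι ℝ) : Prop :=
  A * X * A = A ∧ X * A * X = X ∧ (A * X)ᵀ = A * X ∧ (X * A)ᵀ = X * A

theorem IsMoorePenrose.unique {ι κ : Type*} [Fintype ι] [Fintype κ]
    {A : Matrix ι κ ℝ} {X Y : Matrix κ ι ℝ}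
    (hX : IsMoorePenrose A X) (hY : IsMoorePenrose A Y) : X = Y := by
  obtain ⟨x1, x2, x3, x4⟩ := hX
  obtain ⟨y1, y2, y3, y4⟩ := hY
  have e1 : A * X = A * Y := by
    calc A * X = (A * X)ᵀ := x3.symm
      _ = ((A * Y) * (A * X))ᵀ := by rw [← Matrix.mul_assoc, y1]
      _ = (A * X) * (A * Y) := by rw [Matrix.transpose_mul, x3, y3]
      _ = A * Y := by rw [← Matrix.mul_assoc, x1]
  have e2 : X * A = Y * A := by
    calc X * A = (X * A)ᵀ := x4.symm
      _ = ((X * A) * (Y * A))ᵀ := by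
          rw [Matrix.mul_assoc X A (Y * A), ← Matrix.mul_assoc A Y A, y1]
      _ = (Y * A) * (X * A) := by rw [Matrix.transpose_mul, x4, y4]
      _ = Y * A := by rw [Matrix.mul_assoc Y A (X * A), ← Matrix.mul_assoc A X A, x1]
  calc X = X * A * X := x2.symm
    _ = Y * (A * X) := by rw [e2, Matrix.mul_assoc]
    _ = Y := by rw [e1, ← Matrix.mul_assoc, y2]

theorem exists_isMoorePenrose {ι κ : Type*} [Fintype ι] [Fintype κ]
    (A : Matrix ι κ ℝ) : ∃ X, IsMoorePenrose A X := by
  classical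
  have hG : (Aᵀ * A).IsHermitian := by
    simpa [conjTranspose_eq_transpose_of_trivial] using isHermitian_conjTranspose_mul_self A
  obtain ⟨U, d, hU, hGd⟩ : ∃ (U : Matrix κ κ ℝ) (d : κ → ℝ),
      Uᵀ * U = 1 ∧ Aᵀ * A = U * diagonal d * Uᵀ := by
    refine ⟨(hG.eigenvectorUnitary : Matrix κ κ ℝ), hG.eigenvalues, ?_, ?_⟩
    · have := Unitary.coe_star_mul_self hG.eigenvectorUnitary
      simpa [star_eq_conjTranspose, conjTranspose_eq_transpose_of_trivial] using this
    · have := hG.spectral_theorem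
      rw [Unitary.conjStarAlgAut_apply] at this
      simpa [star_eq_conjTranspose, conjTranspose_eq_transpose_of_trivial,
        Function.comp_def] using this
  set H : Matrix κ κ ℝ := U * diagonal (fun i => (d i)⁻¹) * Uᵀ with hH
  have key : ∀ a b : κ → ℝ, (U * diagonal a * Uᵀ) * (U * diagonal b * Uᵀ)
      = U * diagonal (fun i => a i * b i) * Uᵀ := by
    intro a b
    calc (U * diagonal a * Uᵀ) * (U * diagonal b * Uᵀ)
        = U * diagonal a * (Uᵀ * U) * diagonal b * Uᵀ := by simp only [Matrix.mul_assoc]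
      _ = _ := by rw [hU, Matrix.mul_one, Matrix.mul_assoc U, diagonal_mul_diagonal]
  have sym : ∀ a : κ → ℝ, (U * diagonal a * Uᵀ)ᵀ = U * diagonal a * Uᵀ := by
    intro a; simp [Matrix.mul_assoc]
  have hdd : ∀ i, d i * (d i)⁻¹ * d i = d i := fun i => mul_inv_mul_cancel (d i)
  have hdd' : ∀ i, (d i)⁻¹ * d i * (d i)⁻¹ = (d i)⁻¹ := fun i => by
    simpa using mul_inv_mul_cancel (d i)⁻¹
  refine ⟨H * Aᵀ, ?_, ?_, ?_, ?_⟩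
  · have h0 : Aᴴ * A * (H * (Aᵀ * A) - 1) = 0 := by
      rw [conjTranspose_eq_transpose_of_trivial, Matrix.mul_sub, Matrix.mul_one,
        ← Matrix.mul_assoc, hGd, hH, key, key]
      simp [hdd]
    rw [Matrix.conjTranspose_mul_self_mul_eq_zero, Matrix.mul_sub, Matrix.mul_one,
      sub_eq_zero] at h0
    simpa only [Matrix.mul_assoc] using h0
  · have : H * (Aᵀ * A) * H = H := by
      rw [hGd, hH, key, key]; simp [hdd']
    calc H * Aᵀ * A * (H * Aᵀ) = (H * (Aᵀ * A) * H) * Aᵀ := by simp only [Matrix.mul_assoc]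
      _ = H * Aᵀ := by rw [this]
  · have hs : Hᵀ = H := sym _
    simp [Matrix.transpose_mul, hs, Matrix.mul_assoc]
  · rw [Matrix.mul_assoc, hGd, hH, key]; exact sym _

/-- The Moore-Penrose pseudo-inverse of a real matrix. -/
def pinv {ι κ : Type*} [Fintype ι] [Fintype κ] (A : Matrix ι κ ℝ) : Matrix κ ι ℝ :=
  (exists_isMoorePenrose A).choose

/-- Generalized Schur complement `M | M₂₂ = M₁₁ - M₁₂ M₂₂† M₂₁`. -/
def schurCompl {ι κ : Type*} [Fintype ι] [Fintype κ]
    (M : Matrix (ι ⊕ κ) (ι ⊕ κ) ℝ) : Matrix ι ι ℝ :=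
  M.toBlocks₁₁ - M.toBlocks₁₂ * pinv M.toBlocks₂₂ * M.toBlocks₂₁

/-- The solution set `{Z | [I; Z]ᵀ M [I; Z] ≥ 0}` of a quadratic matrix inequality. -/
def qmiSet {ι κ : Type*} [Fintype ι] [Fintype κ] [DecidableEq ι]
    (M : Matrix (ι ⊕ κ) (ι ⊕ κ) ℝ) : Set (Matrix κ ι ℝ) :=
  {Z | ((fromRows (1 : Matrix ι ι ℝ) Z)ᵀ * M * fromRows (1 : Matrix ι ι ℝ) Z).PosSemidef}

/-! ## Quadratic difference forms -/

/-- The quadratic difference form with coefficient matrix `Φ`, made of `K × K` blocks: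
`Q_Φ(w)(t) = ∑ₖ ∑ₗ w(t+k)ᵀ Φₖₗ w(t+l)`. -/
def qdf {K : ℕ} {ι : Type*} [Fintype ι] (Φ : Matrix (Fin K × ι) (Fin K × ι) ℝ)
    (w : ℕ → ι → ℝ) (t : ℕ) : ℝ :=
  ∑ k : Fin K, ∑ l : Fin K,
    w (t + k) ⬝ᵥ ((of fun a b => Φ (k, a) (l, b)) *ᵥ w (t + l))

/-- `∇Φ = diag(0, Φ) - diag(Φ, 0)`. -/
def nabla {K : ℕ} {ι : Type*} (Φ : Matrix (Fin K × ι) (Fin K × ι) ℝ) :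
    Matrix (Fin (K + 1) × ι) (Fin (K + 1) × ι) ℝ :=
  (of fun r s => Fin.cases 0 (fun i => Fin.cases 0 (fun j => Φ (i, r.2) (j, s.2)) s.1) r.1)
  - (of fun r s =>
      Fin.lastCases 0 (fun i => Fin.lastCases 0 (fun j => Φ (i, r.2) (j, s.2)) s.1) r.1)

/-- The quadratic difference form of `Φ` is nonnegative on the set of trajectories `B`. -/
def QdfNonnegOn {K : ℕ} {ι : Type*} [Fintype ι] (Φ : Matrix (Fin K × ι) (Fin K × ι) ℝ)
    (B : Set (ℕ → ι → ℝ)) : Prop :=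
  ∀ w ∈ B, ∀ t, 0 ≤ qdf Φ w t

/-- The quadratic difference form of `Φ` is negative on the set of trajectories `B`: it is
nonpositive there, and the only trajectory in `B` on which it vanishes identically is zero. -/
def QdfNegOn {K : ℕ} {ι : Type*} [Fintype ι] (Φ : Matrix (Fin K × ι) (Fin K × ι) ℝ)
    (B : Set (ℕ → ι → ℝ)) : Prop :=
  (∀ w ∈ B, ∀ t, qdf Φ w t ≤ 0) ∧ ∀ w ∈ B, (∀ t, qdf Φ w t = 0) ↔ w = 0

/-- `Q_Ψ` is a Lyapunov function for the autonomous system with behavior `B`. -/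
def IsLyapunov {K : ℕ} {ι : Type*} [Fintype ι] (Ψ : Matrix (Fin K × ι) (Fin K × ι) ℝ)
    (B : Set (ℕ → ι → ℝ)) : Prop :=
  QdfNonnegOn Ψ B ∧ QdfNegOn (nabla Ψ) B

/-! ## Systems, controllers, closed loops -/

/-- Index set of `w = col(u, y)`, of size `q = m + p`. -/
abbrev Chan (m p : ℕ) : Type := Fin m ⊕ Fin p

/-- Index set of `col(w(t), …, w(t + L - 1))`, of size `q L`. -/
abbrev Idx (m p L : ℕ) : Type := Fin L × Chan m p

/-- The system `y(t+L) + ∑ᵢ Pᵢ y(t+i) = ∑ᵢ Qᵢ u(t+i) + v(t)`, where `i` runs over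
`0, …, L - 1`. -/
structure IOSystem (m p L : ℕ) where
  P : Fin L → Matrix (Fin p) (Fin p) ℝ
  Q : Fin L → Matrix (Fin p) (Fin m) ℝ

/-- The coefficient matrix `R = [-Q₀ P₀ -Q₁ P₁ ⋯ ]`. -/
def IOSystem.coeff {m p L : ℕ} (S : IOSystem m p L) : Matrix (Fin p) (Idx m p L) ℝ :=
  of fun r k => Sum.elim (fun a => -S.Q k.1 r a) (fun b => S.P k.1 r b) k.2

/-- The controller `u(t+L) + ∑ᵢ Gᵢ u(t+i) = ∑ᵢ Fᵢ y(t+i)`, where `i` runs over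
`0, …, L - 1`. -/
structure Controller (m p L : ℕ) where
  G : Fin L → Matrix (Fin m) (Fin m) ℝ
  F : Fin L → Matrix (Fin m) (Fin p) ℝ

/-- The controller with coefficient matrix `C = [G₀ -F₀ G₁ -F₁ ⋯ ]`. -/
def Controller.ofCoeff {m p L : ℕ} (C : Matrix (Fin m) (Idx m p L) ℝ) :
    Controller m p L where
  G i := of fun r a => C r (i, Sum.inl a)
  F i := of fun r b => -C r (i, Sum.inr b)

/-- The behavior (all solutions `w = col(u, y)` on `ℤ₊`) of the noise-free closed loop. -/
def closedLoop {m p L : ℕ} (S : IOSystem m p L) (K : Controller m p L) :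
    Set (ℕ → Chan m p → ℝ) :=
  {w | ∃ (u : ℕ → Fin m → ℝ) (y : ℕ → Fin p → ℝ), (w = fun t => Sum.elim (u t) (y t)) ∧
    (∀ t, u (t + L) + ∑ i : Fin L, K.G i *ᵥ u (t + i) = ∑ i : Fin L, K.F i *ᵥ y (t + i)) ∧
    (∀ t, y (t + L) + ∑ i : Fin L, S.P i *ᵥ y (t + i) = ∑ i : Fin L, S.Q i *ᵥ u (t + i))}

/-- `K` stabilizes `S`: all solutions of the noise-free closed loop tend to zero. -/
def Stabilizes {m p L : ℕ} (K : Controller m p L) (S : IOSystem m p L) : Prop :=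
  ∀ w ∈ closedLoop S K, Tendsto w atTop (𝓝 0)

/-! ## Data -/

/-- The matrix `H'₁(w)`: the first `q L` rows of the Hankel matrix; its entry in block row `i`
and column `t` is `w(t + i)`. -/
def hankel₁ {m p L T : ℕ} (hLT : L ≤ T) (u : Fin (T + 1) → Fin m → ℝ)
    (y : Fin (T + 1) → Fin p → ℝ) : Matrix (Idx m p L) (Fin (T - L + 1)) ℝ :=
  of fun k t => Sum.elim (u ⟨t + k.1, by omega⟩) (y ⟨t + k.1, by omega⟩) k.2

/-- The matrix `H'₂(w) = [y(L) ⋯ y(T)]`. -/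
def hankel₂ {p L T : ℕ} (hLT : L ≤ T) (y : Fin (T + 1) → Fin p → ℝ) :
    Matrix (Fin p) (Fin (T - L + 1)) ℝ :=
  of fun r t => y ⟨t + L, by omega⟩ r

/-- The system `S` is compatible with the data: it explains them with some noise matrix `V`
for which `Vᵀ` solves the noise inequality. -/
def Compatible {m p L T : ℕ} (hLT : L ≤ T)
    (Pn : Matrix (Fin p ⊕ Fin (T - L + 1)) (Fin p ⊕ Fin (T - L + 1)) ℝ)
    (u : Fin (T + 1) → Fin m → ℝ) (y : Fin (T + 1) → Fin p → ℝ) (S : IOSystem m p L) : Prop :=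
  ∃ V : Matrix (Fin p) (Fin (T - L + 1)) ℝ, Vᵀ ∈ qmiSet Pn ∧
    S.coeff * hankel₁ hLT u y + hankel₂ hLT y = V

/-- `N = [I H'₂; 0 H'₁] Π [I H'₂; 0 H'₁]ᵀ`. -/
def dataN {m p L T : ℕ} (hLT : L ≤ T)
    (Pn : Matrix (Fin p ⊕ Fin (T - L + 1)) (Fin p ⊕ Fin (T - L + 1)) ℝ)
    (u : Fin (T + 1) → Fin m → ℝ) (y : Fin (T + 1) → Fin p → ℝ) :
    Matrix (Fin p ⊕ Idx m p L) (Fin p ⊕ Idx m p L) ℝ :=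
  let E : Matrix (Fin p ⊕ Idx m p L) (Fin p ⊕ Fin (T - L + 1)) ℝ :=
    fromBlocks 1 (hankel₂ hLT y) 0 (hankel₁ hLT u y)
  E * Pn * Eᵀ

/-- The block column `[A; B; D]` with `L` block rows of size `q = m + p`: `A` fills the first
`L - 1` of them, and the last one consists of the `m` rows of `B` and the `p` rows of `D`. -/
def stack {m p L : ℕ} {κ : Type*} (A : Matrix (Idx m p (L - 1)) κ ℝ)
    (B : Matrix (Fin m) κ ℝ) (D : Matrix (Fin p) κ ℝ) : Matrix (Idx m p L) κ ℝ :=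
  of fun r k =>
    if h : (r.1 : ℕ) < L - 1 then A (⟨r.1, h⟩, r.2) k
    else Sum.elim (fun a => B a k) (fun b => D b k) r.2

/-- The data are informative for quadratic stabilization: there are `C` and `Ψ ≥ 0` with
`[I; -C; -R]ᵀ ∇Ψ [I; -C; -R] < 0` for all `R` with `[I; Rᵀ]ᵀ N [I; Rᵀ] ≥ 0`. -/
def Informative {m p L T : ℕ} (hLT : L ≤ T)
    (Pn : Matrix (Fin p ⊕ Fin (T - L + 1)) (Fin p ⊕ Fin (T - L + 1)) ℝ)
    (u : Fin (T + 1) → Fin m → ℝ) (y : Fin (T + 1) → Fin p → ℝ) : Prop :=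
  ∃ (C : Matrix (Fin m) (Idx m p L) ℝ) (Ψ : Matrix (Idx m p L) (Idx m p L) ℝ),
    Ψ.PosSemidef ∧
    ∀ R : Matrix (Fin p) (Idx m p L) ℝ, Rᵀ ∈ qmiSet (dataN hLT Pn u y) →
      (-((stack (L := L + 1) (1 : Matrix (Idx m p L) (Idx m p L) ℝ) (-C) (-R))ᵀ * nabla Ψ *
        stack (L := L + 1) (1 : Matrix (Idx m p L) (Idx m p L) ℝ) (-C) (-R))).PosDef

/-! ## The matrices of the linear matrix inequalities -/

/-- The row `[0 0 -I_p]` of size `p × q L`. -/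
def selP (m p L : ℕ) : Matrix (Fin p) (Idx m p L) ℝ :=
  (stack 0 0 (-1))ᵀ

/-- `N̄ = diag([0 0 -I_p], I)ᵀ N diag([0 0 -I_p], I)`. -/
def Nbar {m p L T : ℕ} (hLT : L ≤ T)
    (Pn : Matrix (Fin p ⊕ Fin (T - L + 1)) (Fin p ⊕ Fin (T - L + 1)) ℝ)
    (u : Fin (T + 1) → Fin m → ℝ) (y : Fin (T + 1) → Fin p → ℝ) :
    Matrix (Idx m p L ⊕ Idx m p L) (Idx m p L ⊕ Idx m p L) ℝ :=
  let E : Matrix (Fin p ⊕ Idx m p L) (Idx m p L ⊕ Idx m p L) ℝ :=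
    fromBlocks (selP m p L) 0 0 1
  Eᵀ * dataN hLT Pn u y * E

/-- `J = [0 I]` of size `q (L - 1) × q L`. -/
def matJ (m p L : ℕ) : Matrix (Idx m p (L - 1)) (Idx m p L) ℝ :=
  of fun r k => if (k.1 : ℕ) = r.1 + 1 ∧ k.2 = r.2 then 1 else 0

/-- The matrix `W = [I 0 0; 0 0 0; 0 I_p 0; 0 0 I]` of size `2 q L × (2 q L - m)`. -/
def matW (m p L : ℕ) :
    Matrix (Idx m p L ⊕ Idx m p L) ((Idx m p (L - 1) ⊕ Fin p) ⊕ Idx m p L) ℝ :=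
  fromBlocks (stack (fromCols 1 0) 0 (fromCols 0 1)) 0 0 1

/-- The row `[Jᵀ 0 I]`. -/
def matY (m p L : ℕ) :
    Matrix (Idx m p L) ((Idx m p (L - 1) ⊕ Fin p) ⊕ Idx m p L) ℝ :=
  fromCols (fromCols (matJ m p L)ᵀ 0) 1

/-- `diag(diag(Φ, 0) - N̄, -Φ)`. -/
def midMat {ι : Type*} (Nb : Matrix (ι ⊕ ι) (ι ⊕ ι) ℝ) (Φ : Matrix ι ι ℝ) :
    Matrix ((ι ⊕ ι) ⊕ ι) ((ι ⊕ ι) ⊕ ι) ℝ :=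
  fromBlocks (fromBlocks Φ 0 0 0 - Nb) 0 0 (-Φ)

/-- The linear matrix inequality in the single unknown `Φ`:
`[W; Jᵀ 0 I]ᵀ diag(diag(Φ, 0) - N̄, -Φ) [W; Jᵀ 0 I] > 0`. -/
def ReducedLMI {m p L : ℕ} (Nb : Matrix (Idx m p L ⊕ Idx m p L) (Idx m p L ⊕ Idx m p L) ℝ)
    (Φ : Matrix (Idx m p L) (Idx m p L) ℝ) : Prop :=
  ((fromRows (matW m p L) (matY m p L))ᵀ * midMat Nb Φ *
    fromRows (matW m p L) (matY m p L)).PosDef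

/-- The matrix inequality in `Φ` and the controller coefficient matrix `C`:
`Eᵀ diag(diag(Φ, 0) - N̄, -Φ) E > 0`, where `E = [I 0; 0 I; Kᵀ I]` and `K = [J; -C; 0]`. -/
def ControllerQMI {m p L : ℕ}
    (Nb : Matrix (Idx m p L ⊕ Idx m p L) (Idx m p L ⊕ Idx m p L) ℝ)
    (Φ : Matrix (Idx m p L) (Idx m p L) ℝ) (C : Matrix (Fin m) (Idx m p L) ℝ) : Prop :=
  let E : Matrix ((Idx m p L ⊕ Idx m p L) ⊕ Idx m p L) (Idx m p L ⊕ Idx m p L) ℝ :=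
    fromRows 1 (fromCols (stack (matJ m p L) (-C) 0)ᵀ 1)
  (Eᵀ * midMat Nb Φ * E).PosDef

/-- `Wᵀ (diag(Φ, 0) - N̄) W`, the matrix that is inverted in the controller formula. -/
def gramW {m p L : ℕ} (Nb : Matrix (Idx m p L ⊕ Idx m p L) (Idx m p L ⊕ Idx m p L) ℝ)
    (Φ : Matrix (Idx m p L) (Idx m p L) ℝ) :
    Matrix ((Idx m p (L - 1) ⊕ Fin p) ⊕ Idx m p L)
      ((Idx m p (L - 1) ⊕ Fin p) ⊕ Idx m p L) ℝ :=
  (matW m p L)ᵀ * (fromBlocks Φ 0 0 0 - Nb) * matW m p L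

/-- The controller coefficient matrix `C`, given by
`Cᵀ = -[Jᵀ 0 I] (Wᵀ (diag(Φ, 0) - N̄) W)⁻¹ Wᵀ diag(Φ, 0) [0; I_m; 0]`. -/
def controllerCoeff {m p L : ℕ}
    (Nb : Matrix (Idx m p L ⊕ Idx m p L) (Idx m p L ⊕ Idx m p L) ℝ)
    (Φ : Matrix (Idx m p L) (Idx m p L) ℝ) : Matrix (Fin m) (Idx m p L) ℝ :=
  let Φ₀ : Matrix (Idx m p L ⊕ Idx m p L) (Idx m p L ⊕ Idx m p L) ℝ := fromBlocks Φ 0 0 0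
  let E : Matrix (Idx m p L ⊕ Idx m p L) (Fin m) ℝ := fromRows (stack 0 1 0) 0
  (-(matY m p L * (gramW Nb Φ)⁻¹ * (matW m p L)ᵀ * Φ₀ * E))ᵀ

end ARStab

end

open Matrix Filter Topology

noncomputable section

/-! Stacking `L` consecutive values of `w` into a state turns the noise-free closed loop into x⁺ = A
x with A = `loopMat C R`, and informativity becomes Ψ - Aᵀ Ψ A > 0 for every R in the data set. One
such R already forces Ψ > 0, and the two Schur complements of [Φ A; Aᵀ Φ⁻¹] give the dual form Φ - A
Φ Aᵀ > 0 with Φ = Ψ⁻¹ (`posDef_sub_dual`). There R enters only through Aᵀ s = Kᵀ s + t, where t = Rᵀ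
(`selP` s).

For R in the data set the form of N is nonnegative at (`selP` s, t), that is, the form of N̄ is
nonnegative at (s, t). Conversely, every such pair comes from some R in the data set
(`exists_mem_qmiSet_mulVec_eq`). The quantifier over R is thus an implication between two quadratic
forms, which the strict S-lemma (`exists_posDef_sub_smul`) turns into one inequality: the controller
inequality, after rescaling Φ.

It remains to eliminate C. The row [Kᵀ I] equals [Jᵀ 0 I] on the columns of W and -Cᵀ on the
remaining coordinates. Restriction to the range of W gives (b); dropping the subtracted Φ-term and
taking a Schur complement gives (a). Conversely, (a) makes P = diag(Φ, 0) - N̄ positive definite.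
Extending [Jᵀ 0 I] from the range of W by zero on its P-orthogonal complement keeps the inequality
(`posDef_sub_conj_of_restricted`), and this extension is [Kᵀ I] for the stated C
(`ReducedLMI.controllerQMI`). -/

namespace ARStab

/-! ### Quadratic forms of real matrices. -/

section QuadraticForms

variable {ι κ : Type*} [Fintype ι] [Fintype κ]

/-- The quadratic form `x ↦ xᵀ M x` of a real matrix. -/
def qf (M : Matrix ι ι ℝ) (x : ι → ℝ) : ℝ := x ⬝ᵥ (M *ᵥ x)

theorem posDef_iff_qf {M : Matrix ι ι ℝ} :
    M.PosDef ↔ M.IsSymm ∧ ∀ x, x ≠ 0 → 0 < qf M x := by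
  rw [posDef_iff_dotProduct_mulVec]
  simp [IsHermitian, IsSymm, qf, conjTranspose_eq_transpose_of_trivial]

theorem posSemidef_iff_qf {M : Matrix ι ι ℝ} :
    M.PosSemidef ↔ M.IsSymm ∧ ∀ x, 0 ≤ qf M x := by
  rw [posSemidef_iff_dotProduct_mulVec]
  simp [IsHermitian, IsSymm, qf, conjTranspose_eq_transpose_of_trivial]

theorem qf_conj (M : Matrix ι ι ℝ) (B : Matrix ι κ ℝ) (x : κ → ℝ) :
    qf (Bᵀ * M * B) x = qf M (B *ᵥ x) := by
  simp [qf, ← mulVec_mulVec, dotProduct_mulVec, vecMul_transpose]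

theorem qf_sub (M N : Matrix ι ι ℝ) (x : ι → ℝ) : qf (M - N) x = qf M x - qf N x := by
  simp [qf, sub_mulVec, dotProduct_sub]

theorem qf_neg (M : Matrix ι ι ℝ) (x : ι → ℝ) : qf (-M) x = -qf M x := by
  simp [qf, neg_mulVec]

theorem qf_smul (c : ℝ) (M : Matrix ι ι ℝ) (x : ι → ℝ) : qf (c • M) x = c * qf M x := by
  simp [qf, smul_mulVec]

@[simp] theorem qf_zero (M : Matrix ι ι ℝ) : qf M 0 = 0 := by simp [qf]

theorem qf_smul_vec (M : Matrix ι ι ℝ) (c : ℝ) (x : ι → ℝ) : qf M (c • x) = c ^ 2 * qf M x := by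
  simp only [qf, mulVec_smul, dotProduct_smul, smul_dotProduct, smul_eq_mul]; ring

theorem dotProduct_mulVec_comm {M : Matrix ι ι ℝ} (hM : M.IsSymm) (x y : ι → ℝ) :
    x ⬝ᵥ (M *ᵥ y) = y ⬝ᵥ (M *ᵥ x) := by
  rw [dotProduct_mulVec, ← mulVec_transpose, hM.eq, dotProduct_comm]

theorem qf_add_smul {M : Matrix ι ι ℝ} (hM : M.IsSymm) (x y : ι → ℝ) (τ : ℝ) :
    qf M (x + τ • y) = qf M x + 2 * τ * (x ⬝ᵥ (M *ᵥ y)) + τ ^ 2 * qf M y := by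
  simp only [qf, mulVec_add, mulVec_smul, dotProduct_add, add_dotProduct, dotProduct_smul,
    smul_dotProduct, smul_eq_mul, dotProduct_mulVec_comm hM y x]
  ring

theorem continuous_qf (M : Matrix ι ι ℝ) : Continuous (qf M) := by
  unfold qf; fun_prop

omit [Fintype κ] in
theorem isSymm_conj {M : Matrix ι ι ℝ} (hM : M.IsSymm) (B : Matrix ι κ ℝ) :
    (Bᵀ * M * B).IsSymm := by
  simp [IsSymm, transpose_mul, hM.eq, Matrix.mul_assoc]

theorem PosDef.isSymm {M : Matrix ι ι ℝ} (hM : M.PosDef) : M.IsSymm := (posDef_iff_qf.1 hM).1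

theorem PosDef.qf_pos {M : Matrix ι ι ℝ} (hM : M.PosDef) {x : ι → ℝ} (hx : x ≠ 0) :
    0 < qf M x := (posDef_iff_qf.1 hM).2 x hx

theorem PosDef.qf_nonneg {M : Matrix ι ι ℝ} (hM : M.PosDef) (x : ι → ℝ) :
    0 ≤ qf M x := (posSemidef_iff_qf.1 hM.posSemidef).2 x

theorem PosDef.isUnit_det [DecidableEq ι] {M : Matrix ι ι ℝ} (hM : M.PosDef) :
    IsUnit M.det := (isUnit_iff_isUnit_det M).1 hM.isUnit

theorem PosDef.conj {M : Matrix ι ι ℝ} (hM : M.PosDef) {B : Matrix ι κ ℝ}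
    (hB : ∀ x, B *ᵥ x = 0 → x = 0) : (Bᵀ * M * B).PosDef :=
  posDef_iff_qf.2 ⟨isSymm_conj (PosDef.isSymm hM) B, fun x hx => by
    rw [qf_conj]; exact PosDef.qf_pos hM fun h => hx (hB x h)⟩

omit [Fintype ι] in
theorem PosDef.sub_of_posSemidef_sub {M N : Matrix ι ι ℝ} (h : (M - N).PosDef)
    (hN : N.PosSemidef) : M.PosDef := by
  simpa using h.add_posSemidef hN

/-- Finite-dimensional Cauchy-Schwarz for a positive semidefinite matrix. -/
theorem sq_dotProduct_mulVec_le {M : Matrix ι ι ℝ} (hM : M.PosSemidef) (x y : ι → ℝ) :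
    (x ⬝ᵥ (M *ᵥ y)) ^ 2 ≤ qf M x * qf M y := by
  obtain ⟨hs, hp⟩ := posSemidef_iff_qf.1 hM
  have h := discrim_le_zero (a := qf M y) (b := 2 * (x ⬝ᵥ (M *ᵥ y))) (c := qf M x) fun τ => by
    have := hp (x + τ • y)
    rw [qf_add_smul hs] at this
    linarith
  rw [discrim] at h
  linarith

end QuadraticForms

/-! ### The strict S-lemma. -/

section SLemma

variable {ι : Type*} [Fintype ι]

/-- On the line x + σ y the form of N vanishes at two values of σ of opposite sign, and the form of
M is positive at both. A positive combination of these two inequalities cancels the cross term of M.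
-/
theorem qf_mul_lt_of_sign {M N : Matrix ι ι ℝ} (hM : M.IsSymm) (hN : N.IsSymm)
    (h : ∀ x, x ≠ 0 → 0 ≤ qf N x → 0 < qf M x) {x y : ι → ℝ} (hx : 0 < qf N x)
    (hy : qf N y < 0) : 0 < qf M x * (-qf N y) + qf M y * qf N x := by
  set b := x ⬝ᵥ (N *ᵥ y) with hb
  set s := Real.sqrt (b ^ 2 + qf N x * (-qf N y)) with hs
  have hpos : 0 < qf N x * (-qf N y) := mul_pos hx (by linarith)
  have hs2 : s ^ 2 = b ^ 2 + qf N x * (-qf N y) := Real.sq_sqrt (by positivity)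
  have hsb : |b| < s := by
    rw [hs]; apply Real.lt_sqrt_of_sq_lt; rw [sq_abs]; linarith
  obtain ⟨hb1, hb2⟩ := abs_lt.1 hsb
  set c := -qf N y with hc
  have hc0 : 0 < c := by rw [hc]; linarith
  have hne : ∀ σ : ℝ, x + σ • y ≠ 0 := by
    intro σ h0
    have : x = (-σ) • y := by rw [neg_smul]; exact eq_neg_of_add_eq_zero_left h0
    rw [this, qf_smul_vec] at hx
    nlinarith [sq_nonneg (-σ)]
  have root : ∀ σ : ℝ, c * σ ^ 2 - 2 * b * σ - qf N x = 0 →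
      0 < qf M x + 2 * σ * (x ⬝ᵥ (M *ᵥ y)) + σ ^ 2 * qf M y := by
    intro σ hσ
    rw [← qf_add_smul hM]
    refine h _ (hne σ) ?_
    rw [qf_add_smul hN, ← hb]
    have : qf N y = -c := by rw [hc]; ring
    rw [this]; linarith
  have r1 := root ((b + s) / c) (by field_simp; linarith)
  have r2 := root ((b - s) / c) (by field_simp; linarith)
  set d := x ⬝ᵥ (M *ᵥ y)
  -- The weights s - b and s + b are positive and make the terms linear in σ cancel, since the roots
  -- are (b ± s) / c.
  have k1 : 0 < (s - b) * c ^ 2 * (qf M x + 2 * ((b + s) / c) * d + ((b + s) / c) ^ 2 * qf M y) :=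
    mul_pos (mul_pos (by linarith) (by positivity)) r1
  have k2 : 0 < (s + b) * c ^ 2 * (qf M x + 2 * ((b - s) / c) * d + ((b - s) / c) ^ 2 * qf M y) :=
    mul_pos (mul_pos (by linarith) (by positivity)) r2
  have e : (s - b) * c ^ 2 * (qf M x + 2 * ((b + s) / c) * d + ((b + s) / c) ^ 2 * qf M y) +
      (s + b) * c ^ 2 * (qf M x + 2 * ((b - s) / c) * d + ((b - s) / c) ^ 2 * qf M y)
      = 2 * s * c * (qf M x * c + qf M y * qf N x) := by
    have : s ^ 2 - b ^ 2 = qf N x * c := by rw [hs2]; ring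
    field_simp
    linear_combination (2 * s * qf M y) * this
  have hs0 : 0 < s := lt_of_le_of_lt (abs_nonneg b) hsb
  have : 0 < 2 * s * c * (qf M x * c + qf M y * qf N x) := by rw [← e]; linarith
  exact (mul_pos_iff_of_pos_left (by positivity)).1 this

theorem isCompact_unitSphere : IsCompact {x : ι → ℝ | x ⬝ᵥ x = 1} := by
  refine Metric.isCompact_of_isClosed_isBounded
    (isClosed_eq (by fun_prop) continuous_const) ?_
  refine (Metric.isBounded_closedBall (x := (0 : ι → ℝ)) (r := 1)).subset fun x hx => ?_
  rw [mem_closedBall_zero_iff, pi_norm_le_iff_of_nonneg zero_le_one]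
  intro i
  rw [Real.norm_eq_abs, ← sq_le_one_iff_abs_le_one]
  have hx : x ⬝ᵥ x = 1 := hx
  rw [← hx, dotProduct, sq]
  exact Finset.single_le_sum (f := fun i => x i * x i) (fun j _ => mul_self_nonneg _)
    (Finset.mem_univ i)

theorem exists_unit_smul {x : ι → ℝ} (hx : x ≠ 0) :
    ∃ (c : ℝ) (z : ι → ℝ), 0 < c ∧ z ⬝ᵥ z = 1 ∧ x = c • z := by
  have h : 0 < x ⬝ᵥ x := by
    refine lt_of_le_of_ne (Finset.sum_nonneg fun i _ => mul_self_nonneg _) fun h => hx ?_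
    exact dotProduct_self_eq_zero.1 h.symm
  refine ⟨√(x ⬝ᵥ x), (√(x ⬝ᵥ x))⁻¹ • x, Real.sqrt_pos.2 h, ?_, ?_⟩
  · have := Real.sqrt_pos.2 h
    rw [smul_dotProduct, dotProduct_smul, smul_eq_mul, smul_eq_mul]
    field_simp
    rw [Real.sq_sqrt h.le]
  · rw [smul_smul, mul_inv_cancel₀ (Real.sqrt_pos.2 h).ne', one_smul]

/-- The homogeneous strict S-lemma. -/
theorem exists_posDef_sub_smul {M N : Matrix ι ι ℝ} (hM : M.IsSymm) (hN : N.IsSymm)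
    (h : ∀ x, x ≠ 0 → 0 ≤ qf N x → 0 < qf M x) :
    ∃ α : ℝ, 0 ≤ α ∧ (M - α • N).PosDef := by
  have ne0 : ∀ x : ι → ℝ, x ⬝ᵥ x = 1 → x ≠ 0 := by rintro x hx rfl; simp at hx
  -- A multiplier α must exceed M/N wherever M ≤ 0, where N is negative. `a` is the maximum of this
  -- ratio on the unit sphere, or 0 if there is no such point.
  obtain ⟨a, ha0, haK, ha⟩ : ∃ a : ℝ, 0 ≤ a ∧
      (∀ x : ι → ℝ, x ⬝ᵥ x = 1 → qf M x ≤ 0 → a * qf N x ≤ qf M x) ∧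
      (a = 0 ∨ ∃ y, qf N y < 0 ∧ qf M y = a * qf N y) := by
    set K : Set (ι → ℝ) := {x | x ⬝ᵥ x = 1} ∩ {x | qf M x ≤ 0}
    have hK : IsCompact K :=
      isCompact_unitSphere.inter_right (isClosed_le (continuous_qf M) continuous_const)
    have hneg : ∀ x ∈ K, qf N x < 0 := fun x hx => by
      by_contra hc
      exact absurd (h x (ne0 x hx.1) (not_lt.1 hc)) (not_lt.2 hx.2)
    rcases K.eq_empty_or_nonempty with he | hne
    · refine ⟨0, le_rfl, fun x hx hx' => ?_, Or.inl rfl⟩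
      have : x ∈ K := ⟨hx, hx'⟩
      simp [he] at this
    · obtain ⟨y, hy, hmax⟩ := hK.exists_isMaxOn (f := fun x => qf M x / qf N x) hne
        ((continuous_qf M).continuousOn.div (continuous_qf N).continuousOn
          fun x hx => (hneg x hx).ne)
      refine ⟨qf M y / qf N y, div_nonneg_of_nonpos hy.2 (hneg y hy).le, fun x hx hx' => ?_,
        Or.inr ⟨y, hneg y hy, (div_mul_cancel₀ _ (hneg y hy).ne).symm⟩⟩
      have h1 : qf M x / qf N x ≤ qf M y / qf N y := hmax ⟨hx, hx'⟩
      rwa [div_le_iff_of_neg (hneg x ⟨hx, hx'⟩)] at h1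
  -- Symmetrically, α must satisfy α N < M wherever N ≥ 0. `c` is the maximum of N/M there, so α c <
  -- 1 suffices; using N/M rather than M/N avoids dividing by N = 0.
  obtain ⟨c, hc0, hcK, hc⟩ : ∃ c : ℝ, 0 ≤ c ∧
      (∀ x : ι → ℝ, x ⬝ᵥ x = 1 → 0 ≤ qf N x → qf N x ≤ c * qf M x) ∧
      (c = 0 ∨ ∃ x, 0 < qf N x ∧ qf N x = c * qf M x) := by
    set K : Set (ι → ℝ) := {x | x ⬝ᵥ x = 1} ∩ {x | 0 ≤ qf N x}
    have hK : IsCompact K :=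
      isCompact_unitSphere.inter_right (isClosed_le continuous_const (continuous_qf N))
    have hpos : ∀ x ∈ K, 0 < qf M x := fun x hx => h x (ne0 x hx.1) hx.2
    rcases K.eq_empty_or_nonempty with he | hne
    · refine ⟨0, le_rfl, fun x hx hx' => ?_, Or.inl rfl⟩
      have : x ∈ K := ⟨hx, hx'⟩
      simp [he] at this
    · obtain ⟨y, hy, hmax⟩ := hK.exists_isMaxOn (f := fun x => qf N x / qf M x) hne
        ((continuous_qf N).continuousOn.div (continuous_qf M).continuousOn
          fun x hx => (hpos x hx).ne')
      refine ⟨qf N y / qf M y, div_nonneg hy.2 (hpos y hy).le, fun x hx hx' => ?_, ?_⟩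
      · have h1 : qf N x / qf M x ≤ qf N y / qf M y := hmax ⟨hx, hx'⟩
        rwa [div_le_iff₀ (hpos x ⟨hx, hx'⟩)] at h1
      · rcases (show 0 ≤ qf N y from hy.2).eq_or_lt with h0 | h0
        · left; rw [← h0, zero_div]
        · exact Or.inr ⟨y, h0, (div_mul_cancel₀ _ (hpos y hy).ne').symm⟩
  -- The admissible interval for α is nonempty: when both maxima are attained with the required
  -- signs, the two-vector inequality applies to the maximizers.
  have hac : a * c < 1 := by
    rcases ha with rfl | ⟨y, hy, hya⟩
    · simp
    rcases hc with rfl | ⟨x, hx, hxc⟩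
    · simp
    have := qf_mul_lt_of_sign hM hN h hx hy
    have hMx : 0 < qf M x := h x (by rintro rfl; simp at hx) hx.le
    rw [hya, hxc] at this
    have h2 : 0 < (qf M x * (-qf N y)) * (1 - a * c) := by linarith
    have := (mul_pos_iff_of_pos_left (mul_pos hMx (by linarith))).1 h2
    linarith
  obtain ⟨α, hα, hαc⟩ : ∃ α, a < α ∧ α * c < 1 := by
    refine ⟨a + (1 - a * c) / (1 + c), by
      have : 0 < (1 - a * c) / (1 + c) := div_pos (by linarith) (by linarith)
      linarith, ?_⟩
    have h1 : (1 - a * c) / (1 + c) * c < 1 - a * c := by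
      rw [div_mul_eq_mul_div, div_lt_iff₀ (by linarith)]
      nlinarith
    linarith
  have hα0 : 0 ≤ α := ha0.trans hα.le
  refine ⟨α, hα0, posDef_iff_qf.2 ⟨hM.sub (hN.smul α), fun x hx => ?_⟩⟩
  obtain ⟨r, z, hr, hz, rfl⟩ := exists_unit_smul hx
  rw [qf_smul_vec]
  refine mul_pos (by positivity) ?_
  rw [qf_sub, qf_smul, sub_pos]
  rcases le_or_gt 0 (qf N z) with h0 | h0
  · have hMz := h z (ne0 z hz) h0
    have := hcK z hz h0
    nlinarith [mul_le_mul_of_nonneg_left this hα0]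
  · rcases le_or_gt (qf M z) 0 with h1 | h1
    · have := haK z hz h1
      nlinarith
    · nlinarith

end SLemma

/-! ### Schur complements and duality. -/

section Schur

variable {ι κ : Type*} [Fintype ι] [Fintype κ]

theorem pinv_eq_inv [DecidableEq ι] {M : Matrix ι ι ℝ} (hM : IsUnit M.det) : pinv M = M⁻¹ := by
  refine (exists_isMoorePenrose M).choose_spec.unique ?_
  simp [IsMoorePenrose, Matrix.mul_nonsing_inv _ hM, Matrix.nonsing_inv_mul _ hM]

theorem isSymm_schurCompl {M : Matrix (ι ⊕ κ) (ι ⊕ κ) ℝ} [DecidableEq κ] (hM : M.IsSymm)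
    (hd : IsUnit M.toBlocks₂₂.det) : (schurCompl M).IsSymm := by
  rw [← fromBlocks_toBlocks M, isSymm_fromBlocks_iff] at hM
  obtain ⟨h1, h2, h3, h4⟩ := hM
  rw [schurCompl, pinv_eq_inv hd, ← h2]
  simp [IsSymm, h1.eq, transpose_nonsing_inv, h4.eq, Matrix.mul_assoc]

/-- Completion of squares with respect to the second block. -/
theorem qf_eq_schurCompl_add [DecidableEq κ] {M : Matrix (ι ⊕ κ) (ι ⊕ κ) ℝ} (hM : M.IsSymm)
    (hd : IsUnit M.toBlocks₂₂.det) (s : ι → ℝ) (t : κ → ℝ) :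
    qf M (Sum.elim s t) = qf (schurCompl M) s +
      qf M.toBlocks₂₂ (t + (M.toBlocks₂₂⁻¹ * M.toBlocks₂₁) *ᵥ s) := by
  obtain ⟨h1, h2, h3, h4⟩ := (isSymm_fromBlocks_iff.1 ((fromBlocks_toBlocks M).symm ▸ hM))
  let := invertibleOfIsUnitDet _ hd
  have := schur_complement_eq₂₂ M.toBlocks₁₁ M.toBlocks₁₂ (D := M.toBlocks₂₂) s t h4
  rw [conjTranspose_eq_transpose_of_trivial, h2, fromBlocks_toBlocks] at this
  simp only [star_trivial, ← dotProduct_mulVec] at this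
  rw [schurCompl, pinv_eq_inv hd, qf, qf, qf, this, add_comm, add_comm t]

theorem posDef_of_schurCompl [DecidableEq κ] {M : Matrix (ι ⊕ κ) (ι ⊕ κ) ℝ} (hM : M.IsSymm)
    (hd : M.toBlocks₂₂.PosDef) (hs : (schurCompl M).PosDef) : M.PosDef := by
  refine posDef_iff_qf.2 ⟨hM, fun x hx => ?_⟩
  rw [← Sum.elim_comp_inl_inr x, qf_eq_schurCompl_add hM (PosDef.isUnit_det hd)]
  by_cases h : x ∘ Sum.inl = 0
  · have : x ∘ Sum.inr ≠ 0 := fun h' => hx (by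
      rw [← Sum.elim_comp_inl_inr x, h, h']; ext (i | i) <;> rfl)
    simpa [h] using PosDef.qf_pos hd this
  · exact add_pos_of_pos_of_nonneg (PosDef.qf_pos hs h) (PosDef.qf_nonneg hd _)

/-- The value of the Schur complement at x is the value of M at (x, t), with t chosen to make the
completed square vanish. -/
theorem PosDef.schurCompl [DecidableEq κ] {M : Matrix (ι ⊕ κ) (ι ⊕ κ) ℝ} (hM : M.PosDef) :
    (schurCompl M).PosDef := by
  have hd : M.toBlocks₂₂.PosDef := hM.submatrix Sum.inr_injective
  refine posDef_iff_qf.2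
    ⟨isSymm_schurCompl (PosDef.isSymm hM) (PosDef.isUnit_det hd), fun x hx => ?_⟩
  have := qf_eq_schurCompl_add (PosDef.isSymm hM) (PosDef.isUnit_det hd) x
    (-((M.toBlocks₂₂⁻¹ * M.toBlocks₂₁) *ᵥ x))
  rw [neg_add_cancel, qf_zero, add_zero] at this
  rw [← this]
  refine PosDef.qf_pos hM fun h0 => hx ?_
  simpa using congrArg (fun f => f ∘ Sum.inl) h0

/-- Duality for strict Stein inequalities. -/
theorem posDef_sub_dual [DecidableEq ι] {Φ A : Matrix ι ι ℝ} (hΦ : Φ.PosDef)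
    (h : (Φ - A * Φ * Aᵀ).PosDef) : (Φ⁻¹ - Aᵀ * Φ⁻¹ * A).PosDef := by
  have hu := PosDef.isUnit_det hΦ
  -- The two Schur complements of this matrix are the two sides of the duality; swapping the blocks
  -- passes from one to the other.
  have hs : (fromBlocks Φ A Aᵀ Φ⁻¹).PosDef := by
    refine posDef_of_schurCompl ?_ (by simpa using hΦ.inv) ?_
    · exact isSymm_fromBlocks_iff.2 ⟨PosDef.isSymm hΦ, rfl, by simp, PosDef.isSymm hΦ.inv⟩
    · simpa [schurCompl, pinv_eq_inv (PosDef.isUnit_det hΦ.inv), nonsing_inv_nonsing_inv _ hu]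
        using h
  have h' := PosDef.schurCompl (hs.submatrix (e := Sum.swap) Sum.swap_leftInverse.injective)
  rw [fromBlocks_submatrix_sum_swap_sum_swap] at h'
  simpa [schurCompl, pinv_eq_inv hu] using h'

end Schur

/-! ### Quadratic matrix inequalities and interpolation. -/

section QMI

variable {ι κ : Type*} [Fintype ι] [Fintype κ] [DecidableEq ι]

omit [Fintype κ] in
theorem fromRows_one_mulVec (Z : Matrix κ ι ℝ) (x : ι → ℝ) :
    fromRows (1 : Matrix ι ι ℝ) Z *ᵥ x = Sum.elim x (Z *ᵥ x) := by
  rw [fromRows_mulVec, one_mulVec]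

theorem qf_of_mem_qmiSet {M : Matrix (ι ⊕ κ) (ι ⊕ κ) ℝ} {Z : Matrix κ ι ℝ}
    (hZ : Z ∈ qmiSet M) (x : ι → ℝ) : 0 ≤ qf M (Sum.elim x (Z *ᵥ x)) := by
  rw [← fromRows_one_mulVec, ← qf_conj]
  exact (posSemidef_iff_qf.1 hZ).2 x

theorem mem_qmiSet_iff {M : Matrix (ι ⊕ κ) (ι ⊕ κ) ℝ} (hM : M.IsSymm) {Z : Matrix κ ι ℝ} :
    Z ∈ qmiSet M ↔ ∀ x, 0 ≤ qf M (Sum.elim x (Z *ᵥ x)) := by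
  refine ⟨qf_of_mem_qmiSet, fun h => posSemidef_iff_qf.2 ⟨isSymm_conj hM _, fun x => ?_⟩⟩
  rw [qf_conj, fromRows_one_mulVec]
  exact h x

/-- As the completed square enters with a negative sign, the Schur complement dominates M on the
graph of any Z, so a single solution suffices. -/
theorem schurCompl_posSemidef_of_mem [DecidableEq κ] {M : Matrix (ι ⊕ κ) (ι ⊕ κ) ℝ}
    (hM : M.IsSymm) (hd : (-M.toBlocks₂₂).PosDef) {Z : Matrix κ ι ℝ} (hZ : Z ∈ qmiSet M) :
    (schurCompl M).PosSemidef := by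
  have hu : IsUnit M.toBlocks₂₂.det := by
    rw [← isUnit_iff_isUnit_det]; simpa using hd.isUnit
  refine posSemidef_iff_qf.2 ⟨isSymm_schurCompl hM hu, fun x => ?_⟩
  have h1 := qf_of_mem_qmiSet hZ x
  rw [qf_eq_schurCompl_add hM hu] at h1
  have h2 := PosDef.qf_nonneg hd (Z *ᵥ x + (M.toBlocks₂₂⁻¹ * M.toBlocks₂₁) *ᵥ x)
  rw [qf_neg] at h2
  linarith

/-- Vectors on which the form of `M` is nonnegative are interpolated by solutions of the quadratic
matrix inequality. -/
theorem exists_mem_qmiSet_mulVec_eq [DecidableEq κ] {M : Matrix (ι ⊕ κ) (ι ⊕ κ) ℝ}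
    (hM : M.IsSymm) (hd : (-M.toBlocks₂₂).PosDef) (hS : (schurCompl M).PosSemidef)
    {s : ι → ℝ} {t : κ → ℝ} (hst : 0 ≤ qf M (Sum.elim s t)) :
    ∃ Z ∈ qmiSet M, Z *ᵥ s = t := by
  have hu : IsUnit M.toBlocks₂₂.det := by
    rw [← isUnit_iff_isUnit_det]; simpa using hd.isUnit
  set Zc := M.toBlocks₂₂⁻¹ * M.toBlocks₂₁ with hZc
  set S := schurCompl M with hSdef
  set d := t + Zc *ᵥ s with hdd
  rw [qf_eq_schurCompl_add hM hu] at hst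
  have hB : ∀ x, qf M.toBlocks₂₂ x = -qf (-M.toBlocks₂₂) x := fun x => by rw [qf_neg, neg_neg]
  rw [hB] at hst
  have hS0 := (posSemidef_iff_qf.1 hS).2
  -- If S vanishes at s, then d = 0 and the centre -Zc of the solution set already interpolates.
  rcases (hS0 s).eq_or_lt with h0 | h0
  · have hd0 : d = 0 := by
      by_contra hne
      have := PosDef.qf_pos hd hne
      linarith
    refine ⟨-Zc, (mem_qmiSet_iff hM).2 fun x => ?_, ?_⟩
    · rw [qf_eq_schurCompl_add hM hu, neg_mulVec, neg_add_cancel, qf_zero, add_zero]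
      exact hS0 x
    · rw [neg_mulVec]; exact (eq_neg_of_add_eq_zero_left hd0).symm
  -- The rank-one correction sends s to d. It stays in the solution set by Cauchy-Schwarz for S
  -- together with -M₂₂(d) ≤ S(s).
  · refine ⟨-Zc + (qf S s)⁻¹ • vecMulVec d (S *ᵥ s), (mem_qmiSet_iff hM).2 fun x => ?_, ?_⟩
    · rw [qf_eq_schurCompl_add hM hu, add_mulVec, neg_mulVec, add_right_comm, neg_add_cancel,
        zero_add, smul_mulVec, vecMulVec_mulVec, hB]
      have hcs := sq_dotProduct_mulVec_le hS x s
      simp only [op_smul_eq_smul, qf_smul_vec]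
      rw [dotProduct_comm (S *ᵥ s) x]
      set b := x ⬝ᵥ (S *ᵥ s)
      set e := qf (-M.toBlocks₂₂) d
      have he : e ≤ qf S s := by linarith
      rw [← sub_eq_add_neg, sub_nonneg]
      calc (qf S s)⁻¹ ^ 2 * (b ^ 2 * e) ≤ (qf S s)⁻¹ ^ 2 * ((qf S x * qf S s) * qf S s) := by
            have : 0 ≤ qf S x * qf S s := mul_nonneg (hS0 x) (hS0 s)
            have he0 : 0 ≤ e := PosDef.qf_nonneg hd d
            gcongr
        _ = qf S x := by field_simp
    · rw [add_mulVec, smul_mulVec, vecMulVec_mulVec, op_smul_eq_smul, smul_smul,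
        dotProduct_comm, ← qf, inv_mul_cancel₀ h0.ne', one_smul, hdd, neg_mulVec]
      abel

end QMI

/-! ### Elimination of the controller variable. -/

section Elimination

variable {ι κ μ : Type*} [Fintype ι] [Fintype κ] [Fintype μ] [DecidableEq κ]

/-- Split z = r + W F z with r P-orthogonal to the range of W. The conjugating matrix is Y F, so the
form at z is P(r) plus the restricted form at F z. Both are nonnegative, and r = z if F z = 0. -/
theorem posDef_sub_conj_of_restricted {P : Matrix ι ι ℝ} {W : Matrix ι κ ℝ} {Y : Matrix μ κ ℝ}
    {Φ : Matrix μ μ ℝ} (hP : P.PosDef) (hΦ : Φ.IsSymm) (hG : IsUnit (Wᵀ * P * W).det)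
    (h : (Wᵀ * P * W - Yᵀ * Φ * Y).PosDef) :
    (P - (Y * (Wᵀ * P * W)⁻¹ * Wᵀ * P)ᵀ * Φ * (Y * (Wᵀ * P * W)⁻¹ * Wᵀ * P)).PosDef := by
  set G := Wᵀ * P * W with hGdef
  set F := G⁻¹ * Wᵀ * P with hF
  have hX : Y * G⁻¹ * Wᵀ * P = Y * F := by simp only [hF, Matrix.mul_assoc]
  have hPs := PosDef.isSymm hP
  rw [hX]
  refine posDef_iff_qf.2 ⟨hPs.sub (isSymm_conj hΦ _), fun z hz => ?_⟩
  set r := z - W *ᵥ (F *ᵥ z) with hr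
  have hWPr : Wᵀ *ᵥ (P *ᵥ r) = 0 := by
    have : Wᵀ * P * W * F = Wᵀ * P := by
      rw [← hGdef, hF, Matrix.mul_assoc G⁻¹, ← Matrix.mul_assoc G, Matrix.mul_nonsing_inv _ hG,
        Matrix.one_mul]
    rw [hr]
    simp only [mulVec_sub, mulVec_mulVec, ← Matrix.mul_assoc, this, sub_self]
  have hz' : z = r + (1 : ℝ) • W *ᵥ (F *ᵥ z) := by rw [hr]; simp
  have hq : qf P z = qf P r + qf G (F *ᵥ z) := by
    conv_lhs => rw [hz', qf_add_smul hPs]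
    rw [dotProduct_mulVec_comm hPs, dotProduct_comm, dotProduct_mulVec, ← mulVec_transpose, hWPr,
      hGdef, qf_conj]
    simp
  have hY : qf ((Y * F)ᵀ * Φ * (Y * F)) z = qf (Yᵀ * Φ * Y) (F *ᵥ z) := by
    rw [qf_conj, qf_conj, mulVec_mulVec]
  rw [qf_sub, hq, hY, add_sub_assoc, ← qf_sub]
  by_cases h0 : F *ᵥ z = 0
  · rw [h0, qf_zero, add_zero]
    refine PosDef.qf_pos hP ?_
    rw [hr, h0]; simpa using hz
  · exact add_pos_of_nonneg_of_pos (PosDef.qf_nonneg hP _) (PosDef.qf_pos h h0)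

end Elimination

/-! ### Block columns and the state matrix of the closed loop. -/

section Stack

variable {m p L : ℕ} {κ μ : Type*}

theorem stack_mul [Fintype κ] (A : Matrix (Idx m p (L - 1)) κ ℝ) (B : Matrix (Fin m) κ ℝ)
    (D : Matrix (Fin p) κ ℝ) (X : Matrix κ μ ℝ) :
    stack (L := L) A B D * X = stack (A * X) (B * X) (D * X) := by
  ext ⟨i, a | a⟩ k <;> by_cases h : (i : ℕ) < L - 1 <;> simp [stack, mul_apply, h]

theorem stack_add (A A' : Matrix (Idx m p (L - 1)) κ ℝ) (B B' : Matrix (Fin m) κ ℝ)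
    (D D' : Matrix (Fin p) κ ℝ) :
    stack (L := L) A B D + stack A' B' D' = stack (A + A') (B + B') (D + D') := by
  ext ⟨i, a | a⟩ k <;> by_cases h : (i : ℕ) < L - 1 <;> simp [stack, h]

theorem stack_mulVec_apply [Fintype κ] (A : Matrix (Idx m p (L - 1)) κ ℝ)
    (B : Matrix (Fin m) κ ℝ) (D : Matrix (Fin p) κ ℝ) (x : κ → ℝ) (r : Idx m p L) :
    (stack A B D *ᵥ x) r = if h : (r.1 : ℕ) < L - 1 then (A *ᵥ x) (⟨r.1, h⟩, r.2)
      else Sum.elim (B *ᵥ x) (D *ᵥ x) r.2 := by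
  obtain ⟨i, a | a⟩ := r <;> by_cases h : (i : ℕ) < L - 1 <;>
    simp [stack, mulVec, dotProduct, h]

theorem exists_eq_stack (hL : 0 < L) (Z : Matrix (Idx m p L) κ ℝ) :
    ∃ A B D, Z = stack A B D := by
  refine ⟨of fun r k => Z (⟨r.1, by omega⟩, r.2) k,
    of fun a k => Z (⟨L - 1, by omega⟩, Sum.inl a) k,
    of fun a k => Z (⟨L - 1, by omega⟩, Sum.inr a) k, ?_⟩
  ext ⟨i, c⟩ k
  by_cases h : (i : ℕ) < L - 1
  · simp [stack, h]
  · have hi : (⟨L - 1, by omega⟩ : Fin L) = i := Fin.ext (by simp; omega)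
    obtain a | a := c <;> simp [stack, h, hi]

theorem stack_transpose_mul (hL : 0 < L) (A : Matrix (Idx m p (L - 1)) κ ℝ)
    (B : Matrix (Fin m) κ ℝ) (D : Matrix (Fin p) κ ℝ) (A' : Matrix (Idx m p (L - 1)) μ ℝ)
    (B' : Matrix (Fin m) μ ℝ) (D' : Matrix (Fin p) μ ℝ) :
    (stack (L := L) A B D)ᵀ * stack (L := L) A' B' D' = Aᵀ * A' + Bᵀ * B' + Dᵀ * D' := by
  obtain ⟨l, rfl⟩ : ∃ l, L = l + 1 := ⟨L - 1, by omega⟩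
  ext i j
  simp [stack, mul_apply, Fintype.sum_prod_type, Fin.sum_univ_castSucc (n := l), add_assoc]

theorem matJ_mulVec_apply (x : Idx m p L → ℝ) (r : Idx m p (L - 1)) :
    (matJ m p L *ᵥ x) r = x (⟨r.1 + 1, by omega⟩, r.2) := by
  rw [mulVec, dotProduct, Finset.sum_eq_single (⟨r.1 + 1, by omega⟩, r.2)]
  · simp [matJ]
  · rintro ⟨i, c⟩ - hne
    have : ¬ ((i : ℕ) = r.1 + 1 ∧ c = r.2) := by
      rintro ⟨h1, h2⟩; exact hne (Prod.ext (Fin.ext h1) h2)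
    simp [matJ, this]
  · simp

/-- The state matrix of the closed loop of the system and the controller with coefficient
matrices `R` and `C`. -/
def loopMat (C : Matrix (Fin m) (Idx m p L) ℝ) (R : Matrix (Fin p) (Idx m p L) ℝ) :
    Matrix (Idx m p L) (Idx m p L) ℝ :=
  stack (matJ m p L) (-C) (-R)

theorem loopMat_eq (C : Matrix (Fin m) (Idx m p L) ℝ) (R : Matrix (Fin p) (Idx m p L) ℝ) :
    loopMat C R = stack (matJ m p L) (-C) 0 + (selP m p L)ᵀ * R := by
  rw [selP, transpose_transpose, stack_mul, stack_add, loopMat]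
  simp

/-- This isolates the unknown system: `Z` acts only on `selP m p L *ᵥ x`, the vector at which N is
tested. -/
theorem loopMat_transpose_mulVec (C : Matrix (Fin m) (Idx m p L) ℝ)
    (Z : Matrix (Idx m p L) (Fin p) ℝ) (x : Idx m p L → ℝ) :
    (loopMat C Zᵀ)ᵀ *ᵥ x =
      (stack (matJ m p L) (-C) 0)ᵀ *ᵥ x + Z *ᵥ (selP m p L *ᵥ x) := by
  rw [loopMat_eq, transpose_add, transpose_mul, transpose_transpose, transpose_transpose,
    add_mulVec, mulVec_mulVec]

end Stack

/-! ### Quadratic difference forms along trajectories. -/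

section Nabla

variable {K : ℕ} {ι : Type*}

theorem isSymm_nabla {Ψ : Matrix (Fin K × ι) (Fin K × ι) ℝ} (h : Ψ.IsSymm) :
    (nabla Ψ).IsSymm := by
  refine IsSymm.sub ?_ ?_
  · ext ⟨i, a⟩ ⟨j, b⟩
    refine Fin.cases ?_ (fun i => ?_) i <;> refine Fin.cases ?_ (fun j => ?_) j <;> simp [h.apply]
  · ext ⟨i, a⟩ ⟨j, b⟩
    refine Fin.lastCases ?_ (fun i => ?_) i <;> refine Fin.lastCases ?_ (fun j => ?_) j <;>
      simp [h.apply]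

theorem qf_nabla [Fintype ι] (Ψ : Matrix (Fin K × ι) (Fin K × ι) ℝ)
    (x : Fin (K + 1) × ι → ℝ) :
    qf (nabla Ψ) x = qf Ψ (fun k => x (k.1.succ, k.2)) - qf Ψ (fun k => x (k.1.castSucc, k.2)) := by
  rw [nabla, qf_sub]
  congr 1
  · simp [qf, dotProduct, mulVec, Fintype.sum_prod_type, Fin.sum_univ_succ (n := K)]
  · simp [qf, dotProduct, mulVec, Fintype.sum_prod_type, Fin.sum_univ_castSucc (n := K)]

/-- The vector `col(w(t), …, w(t + K - 1))`. -/
def window (K : ℕ) (w : ℕ → ι → ℝ) (t : ℕ) : Fin K × ι → ℝ := fun k => w (t + k.1) k.2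

theorem qdf_eq_qf [Fintype ι] (Φ : Matrix (Fin K × ι) (Fin K × ι) ℝ) (w : ℕ → ι → ℝ) (t : ℕ) :
    qdf Φ w t = qf Φ (window K w t) := by
  simp only [qdf, qf, dotProduct, mulVec, Fintype.sum_prod_type, window, of_apply, Finset.mul_sum]
  refine Finset.sum_congr rfl fun k _ => ?_
  rw [Finset.sum_comm]

theorem qdf_nabla [Fintype ι] (Ψ : Matrix (Fin K × ι) (Fin K × ι) ℝ) (w : ℕ → ι → ℝ) (t : ℕ) :
    qdf (nabla Ψ) w t = qf Ψ (window K w (t + 1)) - qf Ψ (window K w t) := by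
  rw [qdf_eq_qf, qf_nabla]
  congr 2
  ext k
  simp [window, add_assoc, add_comm 1]

end Nabla

/-! ### From Stein inequalities to stability. -/

section LoopNabla

variable {m p L : ℕ}

/-- The first `L` blocks of [I; -C; -R] x are x itself, and the last `L` blocks are the successor
state. -/
theorem qf_nabla_stack (Ψ : Matrix (Idx m p L) (Idx m p L) ℝ) (C : Matrix (Fin m) (Idx m p L) ℝ)
    (R : Matrix (Fin p) (Idx m p L) ℝ) (x : Idx m p L → ℝ) :
    qf ((stack (L := L + 1) (1 : Matrix (Idx m p L) (Idx m p L) ℝ) (-C) (-R))ᵀ * nabla Ψ *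
      stack (L := L + 1) (1 : Matrix (Idx m p L) (Idx m p L) ℝ) (-C) (-R)) x =
    qf Ψ (loopMat C R *ᵥ x) - qf Ψ x := by
  rw [qf_conj, qf_nabla]
  congr 2
  · ext ⟨i, c⟩
    rw [loopMat, stack_mulVec_apply, stack_mulVec_apply]
    by_cases h : (i : ℕ) < L - 1
    · have h' : ((i.succ : Fin (L + 1)) : ℕ) < L + 1 - 1 := by simp; omega
      rw [dif_pos h, dif_pos h', one_mulVec, matJ_mulVec_apply]
      simp
    · have h' : ¬ ((i.succ : Fin (L + 1)) : ℕ) < L + 1 - 1 := by simp; omega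
      rw [dif_neg h, dif_neg h']
  · ext ⟨i, c⟩
    rw [stack_mulVec_apply]
    have h' : ((i.castSucc : Fin (L + 1)) : ℕ) < L + 1 - 1 := by simp
    rw [dif_pos h', one_mulVec]
    simp

theorem posDef_neg_nabla_stack_iff {Ψ : Matrix (Idx m p L) (Idx m p L) ℝ} (hΨ : Ψ.IsSymm)
    (C : Matrix (Fin m) (Idx m p L) ℝ) (R : Matrix (Fin p) (Idx m p L) ℝ) :
    (-((stack (L := L + 1) (1 : Matrix (Idx m p L) (Idx m p L) ℝ) (-C) (-R))ᵀ * nabla Ψ *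
      stack (L := L + 1) (1 : Matrix (Idx m p L) (Idx m p L) ℝ) (-C) (-R))).PosDef ↔
    (Ψ - (loopMat C R)ᵀ * Ψ * loopMat C R).PosDef := by
  rw [posDef_iff_qf, posDef_iff_qf, iff_true_intro (isSymm_conj (isSymm_nabla hΨ) _).neg,
    iff_true_intro (hΨ.sub (isSymm_conj hΨ _))]
  simp only [qf_neg, qf_nabla_stack, qf_sub, qf_conj Ψ (loopMat C R), neg_sub]

theorem window_succ {S : IOSystem m p L} {C : Matrix (Fin m) (Idx m p L) ℝ}
    {w : ℕ → Chan m p → ℝ} (hw : w ∈ closedLoop S (Controller.ofCoeff C)) (t : ℕ) :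
    window L w (t + 1) = loopMat C S.coeff *ᵥ window L w t := by
  obtain ⟨u, y, rfl, hu, hy⟩ := hw
  ext ⟨i, c⟩
  rw [loopMat, stack_mulVec_apply]
  by_cases h : (i : ℕ) < L - 1
  · rw [dif_pos h, matJ_mulVec_apply]
    simp [window, add_assoc, add_comm 1]
  · rw [dif_neg h]
    have hi : t + 1 + (i : ℕ) = t + L := by omega
    obtain a | a := c
    · have := congrFun (hu t) a
      simp only [Controller.ofCoeff, Pi.add_apply, Finset.sum_apply, mulVec, dotProduct,
        of_apply, neg_mul, Finset.sum_neg_distrib] at this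
      simp only [window, hi, Sum.elim_inl, neg_mulVec, Pi.neg_apply, mulVec, dotProduct,
        Fintype.sum_prod_type, Fintype.sum_sum_type, Sum.elim_inr, Finset.sum_add_distrib]
      linarith
    · have := congrFun (hy t) a
      simp only [Pi.add_apply, Finset.sum_apply, mulVec, dotProduct] at this
      simp only [window, hi, Sum.elim_inl, neg_mulVec, Pi.neg_apply, mulVec, dotProduct,
        Fintype.sum_prod_type, Fintype.sum_sum_type, Sum.elim_inr, Finset.sum_add_distrib,
        IOSystem.coeff, of_apply, neg_mul, Finset.sum_neg_distrib]
      linarith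

/-- Cauchy-Schwarz for D against D⁻¹ eᵢ, whose D-pairing with x is xᵢ. It yields coordinatewise
convergence from convergence of the form. -/
theorem sq_apply_le {ι : Type*} [Fintype ι] [DecidableEq ι] {D : Matrix ι ι ℝ} (hD : D.PosDef)
    (x : ι → ℝ) (i : ι) : x i ^ 2 ≤ qf D x * qf D (D⁻¹ *ᵥ Pi.single i 1) := by
  have := sq_dotProduct_mulVec_le hD.posSemidef x (D⁻¹ *ᵥ Pi.single i 1)
  rwa [mulVec_mulVec, mul_nonsing_inv _ (PosDef.isUnit_det hD), one_mulVec,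
    dotProduct_single_one] at this

/-- A strict solution of the Stein inequality gives stability and a Lyapunov function. -/
theorem stabilizes_and_isLyapunov (hL : 0 < L) {S : IOSystem m p L}
    {C : Matrix (Fin m) (Idx m p L) ℝ} {Ψ : Matrix (Idx m p L) (Idx m p L) ℝ} (hΨ : Ψ.PosDef)
    (hD : (Ψ - (loopMat C S.coeff)ᵀ * Ψ * loopMat C S.coeff).PosDef) :
    Stabilizes (Controller.ofCoeff C) S ∧
      IsLyapunov Ψ (closedLoop S (Controller.ofCoeff C)) := by
  set D := Ψ - (loopMat C S.coeff)ᵀ * Ψ * loopMat C S.coeff with hDdef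
  have step : ∀ w ∈ closedLoop S (Controller.ofCoeff C), ∀ t,
      qf D (window L w t) = qf Ψ (window L w t) - qf Ψ (window L w (t + 1)) := by
    intro w hw t
    rw [hDdef, qf_sub, qf_conj, ← window_succ hw]
  refine ⟨fun w hw => ?_, fun w hw t => ?_, fun w hw t => ?_, fun w hw => ⟨fun h => ?_, ?_⟩⟩
  -- The Ψ-values decrease and are bounded below, so they converge; their successive differences,
  -- the values of D, tend to 0.
  · have hanti : Antitone fun t => qf Ψ (window L w t) := antitone_nat_of_succ_le fun t => by
      have := PosDef.qf_nonneg hD (window L w t)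
      rw [step w hw] at this
      linarith
    have hlim := tendsto_atTop_ciInf hanti ⟨0, by
      rintro _ ⟨t, rfl⟩; exact PosDef.qf_nonneg hΨ _⟩
    have hlim' := hlim.sub (hlim.comp (tendsto_add_atTop_nat 1))
    rw [sub_self] at hlim'
    have hq : Tendsto (fun t => qf D (window L w t)) atTop (𝓝 0) :=
      hlim'.congr fun t => (step w hw t).symm
    rw [tendsto_pi_nhds]
    intro c
    have hsq : Tendsto (fun t => w t c ^ 2) atTop (𝓝 0) := by
      refine squeeze_zero (fun t => sq_nonneg _) (fun t => ?_)
        (by simpa only [zero_mul] using hq.mul_const (qf D (D⁻¹ *ᵥ Pi.single (⟨0, hL⟩, c) 1)))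
      exact sq_apply_le hD (window L w t) (⟨0, hL⟩, c)
    have := (Real.continuous_sqrt.tendsto 0).comp hsq
    simp only [Function.comp_def, Real.sqrt_sq_eq_abs, Real.sqrt_zero] at this
    exact (tendsto_zero_iff_abs_tendsto_zero _).2 this
  · rw [qdf_eq_qf]; exact PosDef.qf_nonneg hΨ _
  · rw [qdf_nabla]
    have := PosDef.qf_nonneg hD (window L w t)
    rw [step w hw] at this
    linarith
  · ext t c
    have h0 : window L w t = 0 := by
      by_contra hne
      have h1 := PosDef.qf_pos hD hne
      have h2 := h t
      rw [qdf_nabla] at h2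
      rw [step w hw] at h1
      linarith
    exact congrFun h0 (⟨0, hL⟩, c)
  · rintro rfl t
    rw [qdf_eq_qf]
    exact qf_zero _

end LoopNabla

/-! ### Coordinates seen by W and coordinates carrying C. -/

section Selectors

variable {m p L : ℕ}

/-- The block column `[0; I_m; 0]`. -/
def selU (m p L : ℕ) : Matrix (Idx m p L ⊕ Idx m p L) (Fin m) ℝ := fromRows (stack 0 1 0) 0

/-- The block row `[Kᵀ I]` with `K = [J; -C; 0]`. -/
def ctrlRow (C : Matrix (Fin m) (Idx m p L) ℝ) :
    Matrix (Idx m p L) (Idx m p L ⊕ Idx m p L) ℝ :=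
  fromCols (stack (matJ m p L) (-C) 0)ᵀ 1

theorem ctrlRow_mulVec (C : Matrix (Fin m) (Idx m p L) ℝ) (s t : Idx m p L → ℝ) :
    ctrlRow C *ᵥ Sum.elim s t = (stack (matJ m p L) (-C) 0)ᵀ *ᵥ s + t := by
  rw [ctrlRow, fromCols_mulVec_sumElim, one_mulVec]

/-- W omits exactly the coordinates in which C appears, so the product does not depend on C. -/
theorem ctrlRow_mul_matW (hL : 0 < L) (C : Matrix (Fin m) (Idx m p L) ℝ) :
    ctrlRow C * matW m p L = matY m p L := by
  rw [ctrlRow, matW, fromCols_mul_fromBlocks, stack_transpose_mul hL, matY, mul_fromCols]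
  simp

theorem ctrlRow_mul_selU (hL : 0 < L) (C : Matrix (Fin m) (Idx m p L) ℝ) :
    ctrlRow C * selU m p L = -Cᵀ := by
  rw [ctrlRow, selU, fromCols_mul_fromRows, stack_transpose_mul hL]
  simp

/-- The columns of `matW` and `selU` together are all the standard unit vectors. -/
theorem eq_of_mul_matW_eq_of_mul_selU_eq (hL : 0 < L) {κ : Type*}
    {X Y : Matrix κ (Idx m p L ⊕ Idx m p L) ℝ} (hW : X * matW m p L = Y * matW m p L)
    (hU : X * selU m p L = Y * selU m p L) : X = Y := by
  rw [← sub_eq_zero, ← Matrix.sub_mul] at hW hU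
  rw [← sub_eq_zero]
  generalize X - Y = D at hW hU ⊢
  obtain ⟨D₁, D₂, rfl⟩ : ∃ D₁ D₂, D = fromCols D₁ D₂ := ⟨_, _, (fromCols_toCols D).symm⟩
  obtain ⟨A, B, C, h⟩ := exists_eq_stack hL D₁ᵀ
  obtain rfl : D₁ = (stack A B C)ᵀ := by rw [← h, transpose_transpose]
  rw [matW, fromCols_mul_fromBlocks, stack_transpose_mul hL, mul_fromCols, mul_fromCols] at hW
  rw [selU, fromCols_mul_fromRows, stack_transpose_mul hL] at hU
  simp only [Matrix.mul_zero, Matrix.mul_one, zero_add, add_zero] at hW hU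
  have hB : B = 0 := by simpa using hU
  have h2 : D₂ = 0 := by
    ext i j; simpa using congrFun (congrFun hW i) (Sum.inr j)
  have h1 := congrArg toCols₁ hW
  rw [toCols₁_fromCols] at h1
  have hA : A = 0 := by
    rw [← transpose_eq_zero]; ext i j; simpa using congrFun (congrFun h1 i) (Sum.inl j)
  have hC : C = 0 := by
    rw [← transpose_eq_zero]; ext i j; simpa using congrFun (congrFun h1 i) (Sum.inr j)
  subst hA hB hC h2
  ext i (⟨j, c | c⟩ | j) <;> simp [stack]

theorem matW_transpose_mul_self (hL : 0 < L) : (matW m p L)ᵀ * matW m p L = 1 := by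
  rw [matW, fromBlocks_transpose, fromBlocks_multiply, stack_transpose_mul hL,
    transpose_fromCols, transpose_fromCols, fromRows_mul_fromCols, fromRows_mul_fromCols]
  simp [fromBlocks_add]

theorem matW_mulVec_eq_zero (hL : 0 < L) (x : (Idx m p (L - 1) ⊕ Fin p) ⊕ Idx m p L → ℝ)
    (hx : matW m p L *ᵥ x = 0) : x = 0 := by
  rw [← one_mulVec x, ← matW_transpose_mul_self hL, ← mulVec_mulVec, hx, mulVec_zero]

end Selectors

/-! ### Block computations for the middle matrix. -/

section MidMat

variable {ι κ : Type*} [Fintype ι] [Fintype κ]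

omit [Fintype κ] in
theorem fromRows_conj_midMat (Nb : Matrix (ι ⊕ ι) (ι ⊕ ι) ℝ) (Φ : Matrix ι ι ℝ)
    (A : Matrix (ι ⊕ ι) κ ℝ) (B : Matrix ι κ ℝ) :
    (fromRows A B)ᵀ * midMat Nb Φ * fromRows A B =
      Aᵀ * (fromBlocks Φ 0 0 0 - Nb) * A - Bᵀ * Φ * B := by
  rw [transpose_fromRows, midMat, fromCols_mul_fromBlocks, fromCols_mul_fromRows]
  simp [sub_eq_add_neg]

theorem qf_fromBlocks_zero (Φ : Matrix ι ι ℝ) (s t : ι → ℝ) :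
    qf (fromBlocks Φ 0 0 0) (Sum.elim s t) = qf Φ s := by
  simp [qf, fromBlocks_mulVec]

omit [Fintype ι] in
theorem isSymm_fromBlocks_zero {Φ : Matrix ι ι ℝ} (hΦ : Φ.IsSymm) :
    (fromBlocks Φ 0 0 0 : Matrix (ι ⊕ ι) (ι ⊕ ι) ℝ).IsSymm :=
  isSymm_fromBlocks_iff.2 ⟨hΦ, by simp, by simp, by simp [IsSymm]⟩

theorem schurCompl_fromBlocks_sub [DecidableEq ι] (Φ : Matrix ι ι ℝ) (Nb : Matrix (ι ⊕ ι) (ι ⊕ ι) ℝ)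
    (hd : IsUnit Nb.toBlocks₂₂.det) :
    schurCompl (fromBlocks Φ 0 0 0 - Nb) = Φ - schurCompl Nb := by
  have h22 : (fromBlocks Φ 0 0 0 - Nb).toBlocks₂₂ = -Nb.toBlocks₂₂ := by ext; simp [toBlocks₂₂]
  have h21 : (fromBlocks Φ 0 0 0 - Nb).toBlocks₂₁ = -Nb.toBlocks₂₁ := by ext; simp [toBlocks₂₁]
  have h12 : (fromBlocks Φ 0 0 0 - Nb).toBlocks₁₂ = -Nb.toBlocks₁₂ := by ext; simp [toBlocks₁₂]
  have h11 : (fromBlocks Φ 0 0 0 - Nb).toBlocks₁₁ = Φ - Nb.toBlocks₁₁ := by ext; simp [toBlocks₁₁]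
  have hd' : IsUnit (-Nb.toBlocks₂₂).det := by
    rw [← isUnit_iff_isUnit_det] at hd ⊢; exact hd.neg
  have hinv : (-Nb.toBlocks₂₂)⁻¹ = -(Nb.toBlocks₂₂)⁻¹ :=
    inv_eq_right_inv (by rw [neg_mul_neg, mul_nonsing_inv _ hd])
  rw [schurCompl, schurCompl, h11, h12, h21, h22, pinv_eq_inv hd, pinv_eq_inv hd', hinv]
  simp only [Matrix.neg_mul, Matrix.mul_neg, neg_neg]
  abel

end MidMat

/-! ### Equivalence of the reduced and the controller inequality. -/

section LMI

variable {m p L : ℕ} {Nb : Matrix (Idx m p L ⊕ Idx m p L) (Idx m p L ⊕ Idx m p L) ℝ}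
  {Φ : Matrix (Idx m p L) (Idx m p L) ℝ}

theorem controllerQMI_iff {C : Matrix (Fin m) (Idx m p L) ℝ} :
    ControllerQMI Nb Φ C ↔
      (fromBlocks Φ 0 0 0 - Nb - (ctrlRow C)ᵀ * Φ * ctrlRow C).PosDef := by
  rw [ControllerQMI, fromRows_conj_midMat, transpose_one, Matrix.one_mul, Matrix.mul_one, ctrlRow]

theorem reducedLMI_iff :
    ReducedLMI Nb Φ ↔ (gramW Nb Φ - (matY m p L)ᵀ * Φ * matY m p L).PosDef := by
  rw [ReducedLMI, fromRows_conj_midMat, gramW]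

theorem ControllerQMI.reducedLMI (hL : 0 < L) {C : Matrix (Fin m) (Idx m p L) ℝ}
    (h : ControllerQMI Nb Φ C) : ReducedLMI Nb Φ := by
  rw [controllerQMI_iff] at h
  rw [reducedLMI_iff, gramW]
  have := PosDef.conj h (matW_mulVec_eq_zero (m := m) (p := p) hL)
  rw [← ctrlRow_mul_matW hL C, transpose_mul]
  convert this using 1
  simp only [Matrix.mul_sub, Matrix.sub_mul, Matrix.mul_assoc]

theorem posDef_fromBlocks_sub (hΦs : Φ.IsSymm) (hN : Nb.IsSymm) (hd : (-Nb.toBlocks₂₂).PosDef)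
    (ha : (Φ - schurCompl Nb).PosDef) : (fromBlocks Φ 0 0 0 - Nb).PosDef := by
  have hu : IsUnit Nb.toBlocks₂₂.det := by
    rw [← isUnit_iff_isUnit_det]; simpa using hd.isUnit
  refine posDef_of_schurCompl ((isSymm_fromBlocks_zero hΦs).sub hN) ?_ ?_
  · have : (fromBlocks Φ 0 0 0 - Nb).toBlocks₂₂ = -Nb.toBlocks₂₂ := by ext; simp [toBlocks₂₂]
    rwa [this]
  · rwa [schurCompl_fromBlocks_sub _ _ hu]

theorem isUnit_gramW (hL : 0 < L) (hP : (fromBlocks Φ 0 0 0 - Nb).PosDef) :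
    IsUnit (gramW Nb Φ).det :=
  PosDef.isUnit_det (PosDef.conj hP (matW_mulVec_eq_zero hL))

theorem ReducedLMI.controllerQMI (hL : 0 < L) (hΦs : Φ.IsSymm)
    (hNU : Nb * selU m p L = 0) (hP : (fromBlocks Φ 0 0 0 - Nb).PosDef)
    (hb : ReducedLMI Nb Φ) : ControllerQMI Nb Φ (controllerCoeff Nb Φ) := by
  have hG := isUnit_gramW hL hP
  rw [reducedLMI_iff] at hb
  rw [controllerQMI_iff]
  -- Both sides agree on the columns of W by the definition of the Gram matrix. On the remaining
  -- coordinates N̄ vanishes, so P may be replaced by diag(Φ, 0), which is the formula for C.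
  have hX : ctrlRow (controllerCoeff Nb Φ) =
      matY m p L * (gramW Nb Φ)⁻¹ * (matW m p L)ᵀ * (fromBlocks Φ 0 0 0 - Nb) := by
    refine eq_of_mul_matW_eq_of_mul_selU_eq hL ?_ ?_
    · rw [ctrlRow_mul_matW hL]
      have : (matW m p L)ᵀ * (fromBlocks Φ 0 0 0 - Nb) * matW m p L = gramW Nb Φ := rfl
      rw [Matrix.mul_assoc, Matrix.mul_assoc (_ * _) (matW m p L)ᵀ, ← Matrix.mul_assoc _ _ (matW m p L),
        this, Matrix.mul_assoc, nonsing_inv_mul _ hG, Matrix.mul_one]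
    · rw [ctrlRow_mul_selU hL, Matrix.mul_assoc _ _ (selU m p L), Matrix.sub_mul, hNU, sub_zero,
        controllerCoeff, transpose_transpose, neg_neg, ← Matrix.mul_assoc, selU]
  rw [hX]
  exact posDef_sub_conj_of_restricted hP hΦs hG hb

/-- Adding back the semidefinite Φ-term leaves diag(Φ, 0) - N̄ > 0, whose Schur complement is the
claim. -/
theorem ControllerQMI.posDef_sub_schurCompl (hΦ : Φ.PosDef) (hd : IsUnit Nb.toBlocks₂₂.det)
    {C : Matrix (Fin m) (Idx m p L) ℝ} (h : ControllerQMI Nb Φ C) :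
    (Φ - schurCompl Nb).PosDef := by
  rw [controllerQMI_iff] at h
  rw [← schurCompl_fromBlocks_sub _ _ hd]
  refine PosDef.schurCompl (PosDef.sub_of_posSemidef_sub h ?_)
  simpa [conjTranspose_eq_transpose_of_trivial] using
    hΦ.posSemidef.conjTranspose_mul_mul_same (ctrlRow C)

end LMI

/-! ### The data matrices and the set of compatible systems. -/

section Data

variable {m p L T : ℕ} {hLT : L ≤ T}
  {Pn : Matrix (Fin p ⊕ Fin (T - L + 1)) (Fin p ⊕ Fin (T - L + 1)) ℝ}
  {u : Fin (T + 1) → Fin m → ℝ} {y : Fin (T + 1) → Fin p → ℝ}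

theorem isSymm_dataN (hPn : Pn.IsSymm) : (dataN (L := L) hLT Pn u y).IsSymm := by
  have := isSymm_conj hPn (fromBlocks 1 (hankel₂ hLT y) 0 (hankel₁ hLT u y))ᵀ
  rwa [transpose_transpose] at this

theorem isSymm_Nbar (hPn : Pn.IsSymm) : (Nbar (L := L) hLT Pn u y).IsSymm :=
  isSymm_conj (isSymm_dataN hPn) _

theorem qf_Nbar (s t : Idx m p L → ℝ) :
    qf (Nbar hLT Pn u y) (Sum.elim s t) =
      qf (dataN hLT Pn u y) (Sum.elim (selP m p L *ᵥ s) t) := by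
  rw [Nbar, qf_conj, fromBlocks_mulVec]
  simp

theorem Nbar_mul_selU (hL : 0 < L) : Nbar (L := L) hLT Pn u y * selU m p L = 0 := by
  have : fromBlocks (selP m p L) 0 0 (1 : Matrix (Idx m p L) (Idx m p L) ℝ) * selU m p L = 0 := by
    rw [selU, fromBlocks_mul_fromRows, selP, stack_transpose_mul hL]
    simp
  rw [Nbar, Matrix.mul_assoc, this, Matrix.mul_zero]

theorem toBlocks₂₂_dataN : (dataN (L := L) hLT Pn u y).toBlocks₂₂ =
    hankel₁ hLT u y * Pn.toBlocks₂₂ * (hankel₁ hLT u y)ᵀ := by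
  rw [dataN, fromBlocks_transpose]
  conv_lhs => rw [← fromBlocks_toBlocks Pn]
  simp [fromBlocks_multiply]

theorem toBlocks₂₂_Nbar : (Nbar (L := L) hLT Pn u y).toBlocks₂₂ =
    (dataN (L := L) hLT Pn u y).toBlocks₂₂ := by
  rw [Nbar, fromBlocks_transpose]
  conv_lhs => rw [← fromBlocks_toBlocks (dataN hLT Pn u y)]
  simp [fromBlocks_multiply]

/-- Full row rank makes the transposed Hankel matrix injective, so conjugation by it preserves
definiteness. -/
theorem posDef_neg_toBlocks₂₂_dataN (hPn22 : (-Pn.toBlocks₂₂).PosDef)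
    (hrank : (hankel₁ (L := L) hLT u y).rank = (p + m) * L) :
    (-(dataN (L := L) hLT Pn u y).toBlocks₂₂).PosDef := by
  have hinj : ∀ x, (hankel₁ (L := L) hLT u y)ᵀ *ᵥ x = 0 → x = 0 := by
    have hr : (hankel₁ (L := L) hLT u y)ᵀ.rank = Fintype.card (Idx m p L) := by
      rw [rank_transpose, hrank]; simp; ring
    have h1 := (hankel₁ (L := L) hLT u y)ᵀ.mulVecLin.finrank_range_add_finrank_ker
    rw [Module.finrank_fintype_fun_eq_card, ← hr, rank] at h1
    have h2 : LinearMap.ker (hankel₁ (L := L) hLT u y)ᵀ.mulVecLin = ⊥ := by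
      rw [← Submodule.finrank_eq_zero (R := ℝ)]; omega
    intro x hx
    exact (LinearMap.ker_eq_bot'.1 h2) x hx
  have := PosDef.conj hPn22 hinj
  rw [toBlocks₂₂_dataN]
  simpa using this

/-- The transposed data factor of N maps [I; Rᵀ] to [I; Vᵀ], so the noise inequality for V is the
data inequality for R. -/
theorem coeff_transpose_mem (hPn : Pn.IsSymm) {S : IOSystem m p L}
    (hS : Compatible hLT Pn u y S) : S.coeffᵀ ∈ qmiSet (dataN hLT Pn u y) := by
  obtain ⟨V, hV, rfl⟩ := hS
  rw [mem_qmiSet_iff (isSymm_dataN hPn)]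
  intro x
  have h := qf_of_mem_qmiSet hV x
  have e := qf_conj Pn (fromBlocks 1 (hankel₂ hLT y) 0 (hankel₁ hLT u y))ᵀ
    (Sum.elim x (S.coeffᵀ *ᵥ x))
  rw [transpose_transpose] at e
  rw [dataN, e, fromBlocks_transpose, fromBlocks_mulVec]
  convert h using 3
  · simp
  · simp [transpose_add, transpose_mul, add_mulVec, mulVec_mulVec, add_comm]

theorem schurCompl_Nbar_posSemidef (hPn : Pn.IsSymm)
    (hd : (-(dataN (L := L) hLT Pn u y).toBlocks₂₂).PosDef)
    {Z : Matrix (Idx m p L) (Fin p) ℝ} (hZ : Z ∈ qmiSet (dataN hLT Pn u y)) :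
    (schurCompl (Nbar (L := L) hLT Pn u y)).PosSemidef := by
  refine schurCompl_posSemidef_of_mem (Z := Z * selP m p L) (isSymm_Nbar hPn)
    (by rwa [toBlocks₂₂_Nbar]) ((mem_qmiSet_iff (isSymm_Nbar hPn)).2 fun x => ?_)
  rw [qf_Nbar, ← mulVec_mulVec]
  exact qf_of_mem_qmiSet hZ _

/-- The controller inequality gives a strict dual Stein inequality for all systems in the solution
set of the data inequality. -/
theorem ControllerQMI.posDef_sub_loopMat {Φ : Matrix (Idx m p L) (Idx m p L) ℝ} (hΦs : Φ.IsSymm)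
    {C : Matrix (Fin m) (Idx m p L) ℝ} (h : ControllerQMI (Nbar hLT Pn u y) Φ C)
    {R : Matrix (Fin p) (Idx m p L) ℝ} (hR : Rᵀ ∈ qmiSet (dataN hLT Pn u y)) :
    (Φ - loopMat C R * Φ * (loopMat C R)ᵀ).PosDef := by
  rw [controllerQMI_iff] at h
  have hs := isSymm_conj hΦs (loopMat C R)ᵀ
  rw [transpose_transpose] at hs
  refine posDef_iff_qf.2 ⟨hΦs.sub hs, fun s hs => ?_⟩
  have e := qf_conj Φ (loopMat C R)ᵀ s
  have e2 := loopMat_transpose_mulVec C Rᵀ s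
  rw [transpose_transpose] at e e2
  rw [qf_sub, e, e2]
  -- At this vector the form of N̄ is nonnegative by the data inequality, so the term subtracting it
  -- can be dropped.
  have h1 := PosDef.qf_pos h (x := Sum.elim s (Rᵀ *ᵥ (selP m p L *ᵥ s))) fun h0 => hs (by
    simpa using congrArg (fun f => f ∘ Sum.inl) h0)
  have h2 := qf_of_mem_qmiSet hR (selP m p L *ᵥ s)
  rw [qf_sub, qf_sub, qf_conj, ctrlRow_mulVec, qf_fromBlocks_zero, qf_Nbar] at h1
  linarith

/-- Conversely, by the S-lemma, strict dual Stein inequalities for all systems in the solution set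
of the data inequality give the controller inequality up to scaling. -/
theorem exists_controllerQMI (hm : 0 < m) (hL : 0 < L) (hPn : Pn.IsSymm)
    (hd : (-(dataN (L := L) hLT Pn u y).toBlocks₂₂).PosDef)
    {Z₀ : Matrix (Idx m p L) (Fin p) ℝ} (hZ₀ : Z₀ ∈ qmiSet (dataN hLT Pn u y))
    {Φ : Matrix (Idx m p L) (Idx m p L) ℝ} (hΦ : Φ.PosDef) {C : Matrix (Fin m) (Idx m p L) ℝ}
    (h : ∀ R : Matrix (Fin p) (Idx m p L) ℝ, Rᵀ ∈ qmiSet (dataN hLT Pn u y) →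
      (Φ - loopMat C R * Φ * (loopMat C R)ᵀ).PosDef) :
    ∃ c : ℝ, 0 < c ∧ ControllerQMI (Nbar hLT Pn u y) (c • Φ) C := by
  have hΦs := PosDef.isSymm hΦ
  have hN := isSymm_dataN (L := L) (hLT := hLT) (u := u) (y := y) hPn
  set M := fromBlocks Φ 0 0 0 - (ctrlRow C)ᵀ * Φ * ctrlRow C with hM
  have hqM : ∀ s t, qf M (Sum.elim s t) =
      qf Φ s - qf Φ ((stack (matJ m p L) (-C) 0)ᵀ *ᵥ s + t) := fun s t => by
    rw [hM, qf_sub, qf_conj, ctrlRow_mulVec, qf_fromBlocks_zero]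
  obtain ⟨α, hα, hpos⟩ := exists_posDef_sub_smul (M := M)
    ((isSymm_fromBlocks_zero hΦs).sub (isSymm_conj hΦs _))
    (isSymm_Nbar (L := L) (hLT := hLT) (u := u) (y := y) hPn) (fun x hx hx0 => by
      obtain ⟨s, t, rfl⟩ : ∃ s t, x = Sum.elim s t := ⟨_, _, (Sum.elim_comp_inl_inr x).symm⟩
      rw [qf_Nbar] at hx0
      -- Interpolation realises (s, t) by an admissible system, to which the hypothesis `h` applies.
      obtain ⟨Z, hZ, rfl⟩ := exists_mem_qmiSet_mulVec_eq hN hd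
        (schurCompl_posSemidef_of_mem hN hd hZ₀) hx0
      have hs : s ≠ 0 := by
        rintro rfl
        refine hx ?_
        rw [mulVec_zero, mulVec_zero]
        ext (i | i) <;> rfl
      have h1 := PosDef.qf_pos (h Zᵀ (by rwa [transpose_transpose])) hs
      have e := qf_conj Φ (loopMat C Zᵀ)ᵀ s
      rw [transpose_transpose] at e
      rw [qf_sub, e, loopMat_transpose_mulVec] at h1
      rwa [hqM])
  -- With α = 0 the form of M would be positive at (0, t), where it equals -Φ(t) < 0.
  have hα0 : 0 < α := by
    refine hα.lt_of_ne ?_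
    rintro rfl
    let t : Idx m p L → ℝ := fun _ => 1
    have ht : t ≠ 0 := fun h0 =>
      one_ne_zero (congrFun h0 (⟨0, hL⟩, Sum.inl ⟨0, hm⟩) : (1 : ℝ) = 0)
    have h1 := PosDef.qf_pos hpos (x := Sum.elim 0 t) fun h0 => ht (by
      simpa using congrArg (fun f => f ∘ Sum.inr) h0)
    rw [zero_smul, sub_zero, hqM, mulVec_zero, zero_add, qf_zero] at h1
    linarith [PosDef.qf_pos hΦ ht]
  refine ⟨α⁻¹, inv_pos.2 hα0, controllerQMI_iff.2 ?_⟩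
  have := hpos.smul (inv_pos.2 hα0)
  convert this using 1
  have e : (fromBlocks (α⁻¹ • Φ) 0 0 0 : Matrix (Idx m p L ⊕ Idx m p L) (Idx m p L ⊕ Idx m p L) ℝ) =
      α⁻¹ • fromBlocks Φ 0 0 0 := by simp [fromBlocks_smul]
  rw [e, hM, smul_sub, smul_sub, smul_smul, inv_mul_cancel₀ hα0.ne', one_smul, Matrix.mul_smul,
    Matrix.smul_mul]
  abel

end Data

end ARStab

end

/-! ### The main theorem. -/

theorem mainTheorem3 {m p L T : ℕ} (hm : 0 < m) (hp : 0 < p) (hL : 0 < L) (hLT : L ≤ T)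
    (Pn : Matrix (Fin p ⊕ Fin (T - L + 1)) (Fin p ⊕ Fin (T - L + 1)) ℝ)
    (hPn : Pn.IsSymm) (hPn22 : (-Pn.toBlocks₂₂).PosDef)
    (hPnS : (ARStab.schurCompl Pn).PosSemidef)
    (u : Fin (T + 1) → Fin m → ℝ) (y : Fin (T + 1) → Fin p → ℝ)
    (htrue : ∃ S : ARStab.IOSystem m p L, ARStab.Compatible hLT Pn u y S)
    (hrank : (ARStab.hankel₁ (L := L) hLT u y).rank = (p + m) * L) :
    (ARStab.Informative (L := L) hLT Pn u y ↔
      ∃ Φ : Matrix (ARStab.Idx m p L) (ARStab.Idx m p L) ℝ, Φ.IsSymm ∧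
        (Φ - ARStab.schurCompl (ARStab.Nbar hLT Pn u y)).PosDef ∧
        ARStab.ReducedLMI (ARStab.Nbar hLT Pn u y) Φ) ∧
    ∀ Φ : Matrix (ARStab.Idx m p L) (ARStab.Idx m p L) ℝ, Φ.IsSymm →
      (Φ - ARStab.schurCompl (ARStab.Nbar hLT Pn u y)).PosDef →
      ARStab.ReducedLMI (ARStab.Nbar hLT Pn u y) Φ →
      IsUnit (ARStab.gramW (ARStab.Nbar hLT Pn u y) Φ).det ∧
      IsUnit Φ.det ∧
      ARStab.ControllerQMI (ARStab.Nbar hLT Pn u y) Φ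
        (ARStab.controllerCoeff (ARStab.Nbar hLT Pn u y) Φ) ∧
      ∀ S : ARStab.IOSystem m p L, ARStab.Compatible hLT Pn u y S →
        ARStab.Stabilizes (ARStab.Controller.ofCoeff
          (ARStab.controllerCoeff (ARStab.Nbar hLT Pn u y) Φ)) S ∧
        ARStab.IsLyapunov Φ⁻¹ (ARStab.closedLoop S (ARStab.Controller.ofCoeff
          (ARStab.controllerCoeff (ARStab.Nbar hLT Pn u y) Φ))) := by
  obtain ⟨S₀, hS₀⟩ := htrue
  have hR₀ := ARStab.coeff_transpose_mem hPn hS₀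
  have hd := ARStab.posDef_neg_toBlocks₂₂_dataN hPn22 hrank
  have hdb : (-(ARStab.Nbar (L := L) hLT Pn u y).toBlocks₂₂).PosDef := by
    rwa [ARStab.toBlocks₂₂_Nbar]
  have hub : IsUnit (ARStab.Nbar (L := L) hLT Pn u y).toBlocks₂₂.det := by
    rw [← isUnit_iff_isUnit_det]; simpa using hdb.isUnit
  have hSb := ARStab.schurCompl_Nbar_posSemidef hPn hd hR₀
  -- Positivity of Φ comes from (a), because the true system makes the Schur complement of N̄
  -- semidefinite.
  have key : ∀ Φ : Matrix (ARStab.Idx m p L) (ARStab.Idx m p L) ℝ, Φ.IsSymm →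
      (Φ - ARStab.schurCompl (ARStab.Nbar hLT Pn u y)).PosDef →
      ARStab.ReducedLMI (ARStab.Nbar hLT Pn u y) Φ →
      Φ.PosDef ∧ (fromBlocks Φ 0 0 0 - ARStab.Nbar hLT Pn u y).PosDef ∧
      ARStab.ControllerQMI (ARStab.Nbar hLT Pn u y) Φ
        (ARStab.controllerCoeff (ARStab.Nbar hLT Pn u y) Φ) := by
    intro Φ hΦs ha hb
    have hP := ARStab.posDef_fromBlocks_sub hΦs (ARStab.isSymm_Nbar hPn) hdb ha
    exact ⟨ARStab.PosDef.sub_of_posSemidef_sub ha hSb, hP,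
      hb.controllerQMI hL hΦs (ARStab.Nbar_mul_selU hL) hP⟩
  refine ⟨⟨?_, ?_⟩, fun Φ hΦs ha hb => ?_⟩
  · rintro ⟨C, Ψ, hΨ, h⟩
    obtain ⟨hΨs, hΨ0⟩ := ARStab.posSemidef_iff_qf.1 hΨ
    have h' : ∀ R : Matrix (Fin p) (ARStab.Idx m p L) ℝ,
        Rᵀ ∈ ARStab.qmiSet (ARStab.dataN hLT Pn u y) →
        (Ψ - (ARStab.loopMat C R)ᵀ * Ψ * ARStab.loopMat C R).PosDef := fun R hR =>
      (ARStab.posDef_neg_nabla_stack_iff hΨs C R).1 (h R hR)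
    -- For the true system, Ψ exceeds the semidefinite matrix Aᵀ Ψ A strictly.
    have hΨp : Ψ.PosDef := ARStab.PosDef.sub_of_posSemidef_sub (h' _ hR₀) (by
      simpa [conjTranspose_eq_transpose_of_trivial] using
        hΨ.conjTranspose_mul_mul_same (ARStab.loopMat C S₀.coeff))
    obtain ⟨c, hc, hq⟩ := ARStab.exists_controllerQMI hm hL hPn hd hR₀ hΨp.inv (C := C)
      fun R hR => by
        have := ARStab.posDef_sub_dual (A := (ARStab.loopMat C R)ᵀ) hΨp
          (by rw [transpose_transpose]; exact h' R hR)
        rwa [transpose_transpose] at this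
    have hΦ := hΨp.inv.smul hc
    exact ⟨c • Ψ⁻¹, ARStab.PosDef.isSymm hΦ, hq.posDef_sub_schurCompl hΦ hub, hq.reducedLMI hL⟩
  · rintro ⟨Φ, hΦs, ha, hb⟩
    obtain ⟨hΦ, -, hq⟩ := key Φ hΦs ha hb
    refine ⟨ARStab.controllerCoeff (ARStab.Nbar hLT Pn u y) Φ, Φ⁻¹, hΦ.inv.posSemidef, fun R hR =>
      (ARStab.posDef_neg_nabla_stack_iff (ARStab.PosDef.isSymm hΦ.inv) _ R).2 ?_⟩
    exact ARStab.posDef_sub_dual hΦ (hq.posDef_sub_loopMat hΦs hR)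
  · obtain ⟨hΦ, hP, hq⟩ := key Φ hΦs ha hb
    refine ⟨ARStab.isUnit_gramW hL hP, ARStab.PosDef.isUnit_det hΦ, hq, fun S hS => ?_⟩
    exact ARStab.stabilizes_and_isLyapunov hL hΦ.inv (ARStab.posDef_sub_dual hΦ
      (hq.posDef_sub_loopMat hΦs (ARStab.coeff_transpose_mem hPn hS)))
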